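/- Let $d \ge 1$ and let $H$ be a real-valued measurable functional defined on all finite subsets of $\mathbb{R}^d$ (measurable with respect to the $\sigma$-algebra generated by the numbers of points in Borel sets). Assume that $H$ is translation-invariant, that is, $H(y + X) = H(X)$ for all finite $X \subset \mathbb{R}^d$ and all $y \in \mathbb{R}^d$, and write $D_0(X) = H(X \cup \{0\}) - H(X)$ for its add-one cost at the origin. A cube is a set of the form $y + [0,a)^d$. Let $\mathcal{P}(\lambda)$, $\lambda \ge 0$, be a homogeneous Poisson point process on $\mathbb{R}^d$ with density $\lambda$, regarded as a random locally finite subset of $\mathbb{R}^d$, and let $\mathcal{P}(\lambda)|_W$ denote its restriction to $W$. Assume that: (i) $H$ is weakly stabilizing on $\mathcal{P}(\lambda)$: there is a (finite) random variable $\Delta(\lambda)$ such that, for every sequence $(V_k)_{k \ge 1}$ of cubes that contain the origin and tend to $\mathbb{R}^d$ (every point of $\mathbb{R}^d$ lies in $V_k$ for all large $k$), $D_0(\mathcal{P}(\lambda)|_{V_k}) \to \Delta(\lambda)$ almost surely as $k \to \infty$; (ii) for some $p > 2$, $$\sup_{W \ni 0,\ W \text{ a cube}} \mathbb{E}\big[|D_0(\mathcal{P}(\lambda)|_W)|^p\big]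 < \infty.$$ For real $n > 0$ put $\mathcal{P}_n(\lambda) = \mathcal{P}(\lambda)|_{[0, n^{1/d})^d}$. Then $H(\mathcal{P}_n(\lambda))$ has a finite second moment for every $n > 0$, and there is a constant $\hat\sigma^2(\lambda) \in [0, \infty)$, depending only on $H$ and $\lambda$ (and $d$), such that, as $n \to \infty$ through the real numbers, $$\frac{\operatorname{Var}[H(\mathcal{P}_n(\lambda))]}{n} \to \hat\sigma^2(\lambda), \qquad \frac{H(\mathcal{P}_n(\lambda)) - \mathbb{E}[H(\mathcal{P}_n(\lambda))]}{\sqrt{n}} \xrightarrow{d} \mathcal{N}(0, \hat\sigma^2(\lambda)),$$ where $\xrightarrow{d}$ denotes convergence in distribution and $\mathcal{N}(0, 0)$ is the point mass at $0$. -/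

import Mathlib

open MeasureTheory ProbabilityTheory Filter Topology
open scoped NNReal ENNReal

/-- A locally finite subset of `ℝ^d`: only finitely many of its points lie in any bounded set. -/
structure Configuration (d : ℕ) where
  carrier : Set (EuclideanSpace ℝ (Fin d))
  finite_inter : ∀ B : Set (EuclideanSpace ℝ (Fin d)), Bornology.IsBounded B →
    (carrier ∩ B).Finite

namespace Configuration

variable {d : ℕ}

/-- The number of points of the configuration in the set `A`. -/
noncomputable def count (φ : Configuration d) (A : Set (EuclideanSpace ℝ (Fin d))) : ℕ∞ :=
  (φ.carrier ∩ A).encard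

/-- The usual σ-algebra on configurations: the smallest one for which the number of points
in each Borel set is measurable. -/
noncomputable instance : MeasurableSpace (Configuration d) :=
  ⨆ (A : Set (EuclideanSpace ℝ (Fin d))) (_ : MeasurableSet A),
    MeasurableSpace.comap (fun φ : Configuration d => φ.count A) inferInstance

/-- The restriction of a configuration to a bounded set, as a finite set of points. -/
noncomputable def restrict (φ : Configuration d) (W : Set (EuclideanSpace ℝ (Fin d)))
    (hW : Bornology.IsBounded W) : Finset (EuclideanSpace ℝ (Fin d)) :=
  (φ.finite_inter W hW).toFinset

end Configuration

/-- The half-open cube `y + [0, a)^d` (it is empty if `a ≤ 0` and `d ≥ 1`). -/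
def cube {d : ℕ} (y : EuclideanSpace ℝ (Fin d)) (a : ℝ) : Set (EuclideanSpace ℝ (Fin d)) :=
  {x | ∀ i, y i ≤ x i ∧ x i < y i + a}

theorem isBounded_cube {d : ℕ} (y : EuclideanSpace ℝ (Fin d)) (a : ℝ) :
    Bornology.IsBounded (cube y a) := by
  have h : Bornology.IsBounded
      (Set.pi Set.univ (fun i : Fin d => Set.Icc (y i) (y i + a))) :=
    Bornology.IsBounded.pi (fun i => Metric.isBounded_Icc _ _)
  have h2 := (PiLp.antilipschitzWith_ofLp 2 (fun _ : Fin d => ℝ)).isBounded_preimage h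
  refine h2.subset ?_
  intro x hx i _
  exact ⟨(hx i).1, (hx i).2.le⟩

/-- The points of the configuration in the cube `y + [0, a)^d`. -/
noncomputable def Configuration.inCube {d : ℕ} (φ : Configuration d)
    (y : EuclideanSpace ℝ (Fin d)) (a : ℝ) : Finset (EuclideanSpace ℝ (Fin d)) :=
  φ.restrict (cube y a) (isBounded_cube y a)

/-- `P` is a homogeneous Poisson point process on `ℝ^d` with density `lam`, realized on the
probability space `(Ω, μ)`: the number of points in a bounded Borel set `A` is Poisson distributed
with parameter `lam * |A|`, and the numbers of points in disjoint Borel sets are independent. -/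
structure IsHomogeneousPoisson {d : ℕ} {Ω : Type*} [MeasurableSpace Ω] (lam : ℝ≥0)
    (P : Ω → Configuration d) (μ : Measure Ω) : Prop where
  measurable : Measurable P
  hasLaw_count : ∀ A : Set (EuclideanSpace ℝ (Fin d)), MeasurableSet A → Bornology.IsBounded A →
    HasLaw (fun ω => (P ω).count A)
      ((poissonMeasure (lam * (volume A).toNNReal)).map (Nat.cast : ℕ → ℕ∞)) μ
  iIndepFun_count : ∀ (k : ℕ) (A : Fin k → Set (EuclideanSpace ℝ (Fin d))),
    (∀ i, MeasurableSet (A i)) → Pairwise (fun i j => Disjoint (A i) (A j)) →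
    iIndepFun (fun i ω => (P ω).count (A i)) μ

/-- The usual σ-algebra on the finite subsets of `ℝ^d`: the smallest one for which the number of
points in each Borel set is measurable. -/
@[reducible] noncomputable def finiteSubsetSigma (d : ℕ) :
    MeasurableSpace (Finset (EuclideanSpace ℝ (Fin d))) :=
  ⨆ (A : Set (EuclideanSpace ℝ (Fin d))) (_ : MeasurableSet A),
    MeasurableSpace.comap
      (fun s : Finset (EuclideanSpace ℝ (Fin d)) => ((s : Set (EuclideanSpace ℝ (Fin d))) ∩ A).encard)
      inferInstance

/-- Measurability of a real-valued functional of finite subsets of `ℝ^d`. -/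
def MeasurableFunctional {d : ℕ} (H : Finset (EuclideanSpace ℝ (Fin d)) → ℝ) : Prop :=
  Measurable[finiteSubsetSigma d] H

/-- `H(y + X) = H(X)` for all finite sets `X` and all `y`. -/
def TranslationInvariant {d : ℕ} (H : Finset (EuclideanSpace ℝ (Fin d)) → ℝ) : Prop :=
  ∀ (s : Finset (EuclideanSpace ℝ (Fin d))) (y : EuclideanSpace ℝ (Fin d)),
    H (s.map (addLeftEmbedding y)) = H s

open Classical in
/-- The add-one cost `D_x(X) = H(X ∪ {x}) - H(X)`. -/
noncomputable def addOneCost {d : ℕ} (H : Finset (EuclideanSpace ℝ (Fin d)) → ℝ)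
    (x : EuclideanSpace ℝ (Fin d)) (s : Finset (EuclideanSpace ℝ (Fin d))) : ℝ :=
  H (insert x s) - H s

/-- `H` is weakly stabilizing on `P`: for some real random variable `Δ`, along every sequence of
cubes that contain the origin and tend to `ℝ^d` (each point of `ℝ^d` is eventually in the cubes),
the add-one cost at the origin converges almost surely to `Δ`. The exceptional null set may depend
on the sequence. -/
def WeaklyStabilizing {d : ℕ} {Ω : Type*} [MeasurableSpace Ω]
    (H : Finset (EuclideanSpace ℝ (Fin d)) → ℝ) (P : Ω → Configuration d) (μ : Measure Ω) : Prop :=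
  ∃ Δ : Ω → ℝ, Measurable Δ ∧
    ∀ (y : ℕ → EuclideanSpace ℝ (Fin d)) (a : ℕ → ℝ),
      (∀ n, 0 ∈ cube (y n) (a n)) →
      (∀ x : EuclideanSpace ℝ (Fin d), ∀ᶠ n in atTop, x ∈ cube (y n) (a n)) →
      ∀ᵐ ω ∂μ, Tendsto (fun n => addOneCost H 0 ((P ω).inCube (y n) (a n))) atTop (𝓝 (Δ ω))

/-- The uniform `p`-th moment bound: the supremum of `E |D_0(P ∩ W)|^p` over all cubes `W`
containing the origin is finite. -/
def UniformMomentBound {d : ℕ} {Ω : Type*} [MeasurableSpace Ω]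
    (H : Finset (EuclideanSpace ℝ (Fin d)) → ℝ) (P : Ω → Configuration d) (μ : Measure Ω)
    (p : ℝ) : Prop :=
  (⨆ (y : EuclideanSpace ℝ (Fin d)) (a : ℝ) (_ : 0 ∈ cube y a),
    ∫⁻ ω, ‖addOneCost H 0 ((P ω).inCube y a)‖ₑ ^ p ∂μ) < ∞

/-- `H(P_n)`, where `P_n` is the restriction of `P` to the cube `[0, n^{1/d})^d`; here `n` is a
real number. -/
noncomputable def functionalOnCube {d : ℕ} {Ω : Type*}
    (H : Finset (EuclideanSpace ℝ (Fin d)) → ℝ) (P : Ω → Configuration d) (n : ℝ) (ω : Ω) : ℝ :=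
  H ((P ω).inCube 0 (n ^ (1 / (d : ℝ))))

/-!
The proof compares the functional on a large window with a sum of independent copies of a single
random variable, at an error that is controlled in variance by the Poincaré inequality of the
Poisson process.

*Poincaré inequality.* For the Poisson process with finite intensity measure `α`,
`Var G ≤ ∫ E |D_x G|² α(dx)`. The Poisson law is realized on finite sets as the mixture
`poissonLaw α`, and it is the limit of a Markov chain that adds a random point with small
probability in each step. For this chain the inequality is of Efron–Stein type and is proved by
induction on the number of steps: one step increases the variance by at most the mean squared
gradient (`chainStep_sq_sub_le`), and the step operator commutes with the add-one cost
(`addOneCost_chainStep`), so that by Jensen's inequality it decreases the squared gradient. The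
limit gives bounded functionals, and truncation gives the general case `poincare_poissonLaw`,
including the finiteness of the second moment. Counting points in disjoint sets identifies the
restriction of a homogeneous Poisson process to a cube with `poissonLaw` (`map_inCube`), and shows
that its restrictions to disjoint cubes are independent (`iIndepFun_inCube`).

*Stabilization.* Since the moments of order `p > 2` of the add-one cost at the origin are bounded,
weak stabilization holds in `L²`, and it is uniform: there is a radius `r` such that the add-one
costs in any two cubes which contain the box of radius `r` around the origin are close in `L²`
(`exists_radius`).

*Comparison.* The window is filled with disjoint cells of a fixed side length `a`. The add-one cost
at `x` of the difference between the functional and the sum of its values on the cells is the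
difference between the add-one costs in the window and in the cell of `x`. By stationarity it is
small in `L²` if `x` has distance at least `r` from the boundary of its cell, and bounded in `L²` in
any case. As the other points `x` take a small proportion of the volume if `a` is large, the
variance of the difference is at most `ε n` (`variance_sub_sum_cells_le`).

*Conclusion.* The sums over the cells satisfy the classical central limit theorem. The approximation
makes the standard deviations divided by `√n` a Cauchy family, whose limit is the standard deviation
of the Gaussian limit law, and it makes the characteristic functions converge
(`exists_tendsto_of_approx`); Lévy's continuity theorem finishes the proof. The limit variance is
determined by `poissonLaw`, hence it depends on the functional and the density only.
-/

open MeasureTheory ProbabilityTheory Filter Topology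
open scoped NNReal ENNReal

attribute [local instance] finiteSubsetSigma

namespace PoissonCLT

/-! ### Measurability on the space of finite sets -/

section FiniteSets

/-- The space `ℝ^d` that contains the points, with its Euclidean structure. -/
abbrev Pt (d : ℕ) : Type := EuclideanSpace ℝ (Fin d)

variable {d : ℕ}

/-- The number of points of a finite set in `A`, as a real number. -/
noncomputable def ptCount (A : Set (Pt d)) (s : Finset (Pt d)) : ℝ :=
  (((s : Set (Pt d)) ∩ A).ncard : ℝ)

lemma measurable_encard_inter {A : Set (Pt d)} (hA : MeasurableSet A) :
    Measurable (fun s : Finset (Pt d) => ((s : Set (Pt d)) ∩ A).encard) := by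
  refine measurable_iff_comap_le.2 ?_
  exact le_iSup₂ (f := fun (A : Set (Pt d)) (_ : MeasurableSet A) => MeasurableSpace.comap
    (fun s : Finset (Pt d) => ((s : Set (Pt d)) ∩ A).encard) inferInstance) A hA

@[fun_prop]
lemma measurable_ptCount {A : Set (Pt d)} (hA : MeasurableSet A) : Measurable (ptCount A) := by
  have : ptCount A = (fun n : ℕ∞ => (n.toNat : ℝ)) ∘
      (fun s : Finset (Pt d) => ((s : Set (Pt d)) ∩ A).encard) := rfl
  rw [this]
  exact measurable_from_top.comp (measurable_encard_inter hA)

/-- The σ-algebra on finite sets is generated by the real-valued counts. -/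
lemma measurable_finset_of_ptCount {X : Type*} [MeasurableSpace X] {f : X → Finset (Pt d)}
    (h : ∀ A : Set (Pt d), MeasurableSet A → Measurable (fun x => ptCount A (f x))) :
    Measurable f := by
  refine measurable_iff_comap_le.2 ?_
  simp only [finiteSubsetSigma, MeasurableSpace.comap_iSup, MeasurableSpace.comap_comp]
  refine iSup₂_le fun A hA => ?_
  rw [← measurable_iff_comap_le]
  have : (fun s : Finset (Pt d) => ((s : Set (Pt d)) ∩ A).encard) ∘ f =
      (fun r : ℝ => ((⌊r⌋₊ : ℕ) : ℕ∞)) ∘ (fun x => ptCount A (f x)) := by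
    ext x
    simp only [Function.comp, ptCount, Nat.floor_natCast]
    rw [Set.Finite.cast_ncard_eq ((f x).finite_toSet.inter_of_left A)]
  rw [this]
  refine Measurable.comp ?_ (h A hA)
  exact measurable_from_top.comp Nat.measurable_floor

/-- All the counts of a finite set, as a point of a product space. The σ-algebra on finite sets is
the pullback of the product σ-algebra along this map, see `comap_allCounts`. -/
noncomputable def allCounts (s : Finset (Pt d)) : {A : Set (Pt d) // MeasurableSet A} → ℝ :=
  fun A => ptCount A.1 s

lemma measurable_allCounts : Measurable (allCounts (d := d)) :=
  measurable_pi_lambda _ fun A => measurable_ptCount A.2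

lemma comap_allCounts :
    MeasurableSpace.comap (allCounts (d := d)) inferInstance = finiteSubsetSigma d := by
  refine le_antisymm (measurable_iff_comap_le.1 measurable_allCounts) ?_
  have : @Measurable _ _ (MeasurableSpace.comap (allCounts (d := d)) inferInstance)
      (finiteSubsetSigma d) (id : Finset (Pt d) → Finset (Pt d)) := by
    refine @measurable_finset_of_ptCount d _ (MeasurableSpace.comap allCounts inferInstance) _ ?_
    intro A hA
    have h1 : Measurable (fun c : {A : Set (Pt d) // MeasurableSet A} → ℝ => c ⟨A, hA⟩) :=
      measurable_pi_apply _
    exact h1.comp (comap_measurable _)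
  simpa using measurable_iff_comap_le.1 this

open Classical in
lemma ptCount_eq_card (A : Set (Pt d)) (s : Finset (Pt d)) :
    ptCount A s = ((s.filter (· ∈ A)).card : ℝ) := by
  rw [ptCount, ← Set.ncard_coe_finset]
  congr 2
  ext x; simp

open Classical in
lemma ptCount_eq_sum (A : Set (Pt d)) (s : Finset (Pt d)) :
    ptCount A s = ∑ x ∈ s, A.indicator (fun _ => (1 : ℝ)) x := by
  rw [ptCount_eq_card, Finset.card_filter]
  push_cast
  simp only [Set.indicator_apply]

/-- The set of pairs `(x, s)` with `x ∉ s` is measurable: it is the union over a countable basis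
of the products of a basic open set with the event that it contains no point of `s`. -/
lemma measurableSet_notMem : MeasurableSet {q : Pt d × Finset (Pt d) | q.1 ∉ q.2} := by
  have : {q : Pt d × Finset (Pt d) | q.1 ∉ q.2} =
      ⋃ U ∈ TopologicalSpace.countableBasis (Pt d), U ×ˢ {s : Finset (Pt d) | ptCount U s = 0} := by
    ext ⟨x, s⟩
    simp only [Set.mem_ofPred_eq, Set.mem_iUnion, Set.mem_prod, exists_prop]
    constructor
    · intro hx
      obtain ⟨U, hU, hxU, hsub⟩ :=
        (TopologicalSpace.isBasis_countableBasis (Pt d)).exists_subset_of_mem_open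
        (show x ∈ ((s : Set (Pt d))ᶜ) by simpa using hx) s.finite_toSet.isClosed.isOpen_compl
      refine ⟨U, hU, hxU, ?_⟩
      have : ((s : Set (Pt d)) ∩ U) = ∅ := by
        ext y; simp only [Set.mem_inter_iff, Set.mem_empty_iff_false, iff_false, not_and]
        exact fun hy hyU => hsub hyU hy
      simp [ptCount, this]
    · rintro ⟨U, hU, hxU, h0⟩ hxs
      simp only [ptCount, Nat.cast_eq_zero,
        Set.ncard_eq_zero (s.finite_toSet.inter_of_left U)] at h0
      exact (Set.eq_empty_iff_forall_notMem.1 h0 x) ⟨hxs, hxU⟩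
  rw [this]
  refine MeasurableSet.biUnion (TopologicalSpace.countable_countableBasis (Pt d)) fun U hU => ?_
  have hUm : MeasurableSet U := (TopologicalSpace.isOpen_of_mem_countableBasis hU).measurableSet
  exact hUm.prod (measurable_ptCount hUm (measurableSet_singleton 0))

open Classical in
lemma ptCount_insert (A : Set (Pt d)) (x : Pt d) (s : Finset (Pt d)) :
    ptCount A (insert x s) = ptCount A s +
      Set.indicator {q : Pt d × Finset (Pt d) | q.1 ∉ q.2}
        (fun q => A.indicator (fun _ => (1 : ℝ)) q.1)
        (x, s) := by
  rw [ptCount_eq_sum, ptCount_eq_sum]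
  by_cases h : x ∈ s
  · simp [h]
  · rw [Finset.sum_insert h]
    simp [h, add_comm]

open Classical in
lemma measurable_insert : Measurable (fun q : Pt d × Finset (Pt d) => insert q.1 q.2) := by
  refine measurable_finset_of_ptCount fun A hA => ?_
  simp only [ptCount_insert]
  refine ((measurable_ptCount hA).comp measurable_snd).add ?_
  exact ((measurable_const.indicator hA).comp measurable_fst).indicator measurableSet_notMem

open Classical in
lemma ptCount_filter (A C : Set (Pt d)) (s : Finset (Pt d)) :
    ptCount A (s.filter (· ∈ C)) = ptCount (A ∩ C) s := by
  simp only [ptCount_eq_card, Finset.filter_filter, Set.mem_inter_iff, and_comm]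

open Classical in
lemma measurable_filter {C : Set (Pt d)} (hC : MeasurableSet C) :
    Measurable (fun s : Finset (Pt d) => s.filter (· ∈ C)) := by
  refine measurable_finset_of_ptCount fun A hA => ?_
  simp only [ptCount_filter]
  exact measurable_ptCount (hA.inter hC)

lemma ptCount_restrict (φ : Configuration d) (W : Set (Pt d)) (hW : Bornology.IsBounded W)
    (A : Set (Pt d)) :
    ptCount A (φ.restrict W hW) = ((φ.count (A ∩ W)).toNat : ℝ) := by
  simp only [ptCount, Configuration.restrict, Configuration.count, Set.Finite.coe_toFinset,
    Set.ncard, Set.inter_assoc, Set.inter_comm W A]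

lemma measurable_count {A : Set (Pt d)} (hA : MeasurableSet A) :
    Measurable (fun φ : Configuration d => φ.count A) :=
  measurable_iff_comap_le.2 (le_iSup₂ (f := fun (A : Set (Pt d)) (_ : MeasurableSet A) =>
      MeasurableSpace.comap (fun φ : Configuration d => φ.count A) inferInstance) A hA)

lemma measurable_restrict {W : Set (Pt d)} (hW : Bornology.IsBounded W) (hWm : MeasurableSet W) :
    Measurable (fun φ : Configuration d => φ.restrict W hW) := by
  refine measurable_finset_of_ptCount fun A hA => ?_
  simp only [ptCount_restrict]
  exact (measurable_from_top (f := fun n : ℕ∞ => (n.toNat : ℝ))).comp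
    (measurable_count (hA.inter hWm))

lemma measurableSet_cube (y : Pt d) (a : ℝ) : MeasurableSet (cube y a) := by
  have : cube y a = ⋂ i, ({x : Pt d | y i ≤ x i} ∩ {x : Pt d | x i < y i + a}) := by
    ext x; simp [cube]
  rw [this]
  refine MeasurableSet.iInter fun i => ?_
  have h : Measurable (fun x : Pt d => x i) := by fun_prop
  exact (measurableSet_le measurable_const h).inter (measurableSet_lt h measurable_const)

lemma measurable_inCube (y : Pt d) (a : ℝ) :
    Measurable (fun φ : Configuration d => φ.inCube y a) :=
  measurable_restrict _ (measurableSet_cube y a)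

open Classical in
lemma measurable_addOneCost_uncurry {H : Finset (Pt d) → ℝ} (hH : Measurable H) :
    Measurable (fun q : Pt d × Finset (Pt d) => addOneCost H q.1 q.2) :=
  (hH.comp measurable_insert).sub (hH.comp measurable_snd)

lemma measurable_addOneCost {H : Finset (Pt d) → ℝ} (hH : Measurable H) (x : Pt d) :
    Measurable (addOneCost H x) :=
  (measurable_addOneCost_uncurry hH).comp measurable_prodMk_left

end FiniteSets

/-! ### The Poisson law of finite intensity -/

section PoissonLaw

variable {d : ℕ}

open Classical in
/-- The image of `α^k` under `(x₁, …, x_k) ↦ {x₁, …, x_k}`, built one point at a time. The measure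
`α` is not normalized, so this has total mass `α(ℝ^d)^k`. -/
noncomputable def addPoints (α : Measure (Pt d)) : ℕ → Measure (Finset (Pt d))
  | 0 => Measure.dirac ∅
  | k + 1 => (α.prod (addPoints α k)).map (fun q => insert q.1 q.2)

/-- The law of the Poisson process with finite intensity measure `α`, as a measure on finite
sets: conditionally on having `k` points it is the law of `k` independent points. -/
noncomputable def poissonLaw (α : Measure (Pt d)) : Measure (Finset (Pt d)) :=
  Measure.sum fun k : ℕ =>
    ENNReal.ofReal (Real.exp (-α.real Set.univ) / k.factorial) • addPoints α k

variable {α : Measure (Pt d)} [IsFiniteMeasure α]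

instance isFiniteMeasure_addPoints (k : ℕ) : IsFiniteMeasure (addPoints α k) := by
  induction k with
  | zero => rw [addPoints]; infer_instance
  | succ k ih => rw [addPoints]; infer_instance

lemma integrable_of_bounded {F : Type*} [NormedAddCommGroup F] {X : Type*} [MeasurableSpace X]
    {m : Measure X} [IsFiniteMeasure m]
    {Φ : X → F} (hΦ : StronglyMeasurable Φ) {C : ℝ} (hC : ∀ s, ‖Φ s‖ ≤ C) : Integrable Φ m :=
  Integrable.of_bound hΦ.aestronglyMeasurable C (ae_of_all _ hC)

variable {F : Type*} [NormedAddCommGroup F] [NormedSpace ℝ F]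

open Classical in
lemma integral_map_insert {m : Measure (Finset (Pt d))} [IsFiniteMeasure m] {Φ : Finset (Pt d) → F}
    (hΦ : StronglyMeasurable Φ) {C : ℝ} (hC : ∀ s, ‖Φ s‖ ≤ C) :
    ∫ s, Φ s ∂((α.prod m).map (fun q => insert q.1 q.2)) = ∫ s, ∫ x, Φ (insert x s) ∂α ∂m := by
  rw [integral_map measurable_insert.aemeasurable hΦ.aestronglyMeasurable]
  rw [integral_prod_symm]
  exact integrable_of_bounded (hΦ.comp_measurable measurable_insert) (fun _ => hC _)

open Classical in
lemma integral_addPoints_succ {Φ : Finset (Pt d) → F}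
    (hΦ : StronglyMeasurable Φ) {C : ℝ} (hC : ∀ s, ‖Φ s‖ ≤ C) (k : ℕ) :
    ∫ s, Φ s ∂(addPoints α (k + 1)) = ∫ s, ∫ x, Φ (insert x s) ∂α ∂(addPoints α k) := by
  rw [addPoints, integral_map_insert hΦ hC]

lemma addPoints_real_univ (k : ℕ) : (addPoints α k).real Set.univ = α.real Set.univ ^ k := by
  induction k with
  | zero => simp [addPoints]
  | succ k ih =>
    rw [addPoints, map_measureReal_apply measurable_insert MeasurableSet.univ, Set.preimage_univ,
      ← Set.univ_prod_univ, measureReal_prod_prod, ih, pow_succ']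

lemma norm_integral_addPoints_le {Φ : Finset (Pt d) → F} {C : ℝ} (hC : ∀ s, ‖Φ s‖ ≤ C) (k : ℕ) :
    ‖∫ s, Φ s ∂(addPoints α k)‖ ≤ C * α.real Set.univ ^ k := by
  have := norm_integral_le_of_norm_le_const (μ := addPoints α k) (ae_of_all _ hC)
  rwa [addPoints_real_univ] at this

lemma hasSum_exp_factorial (L : ℝ) :
    HasSum (fun k : ℕ => Real.exp (-L) / k.factorial * L ^ k) 1 := by
  have h := (NormedSpace.expSeries_div_hasSum_exp L).mul_left (Real.exp (-L))
  rw [← Real.exp_eq_exp_ℝ, ← Real.exp_add, neg_add_cancel, Real.exp_zero] at h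
  have e : (fun k : ℕ => Real.exp (-L) / k.factorial * L ^ k) =
      fun k : ℕ => Real.exp (-L) * (L ^ k / k.factorial) := by
    funext k; ring
  rw [e]
  exact h

instance isProbabilityMeasure_poissonLaw : IsProbabilityMeasure (poissonLaw α) := by
  constructor
  rw [poissonLaw, Measure.sum_apply _ MeasurableSet.univ]
  have h (k : ℕ) : (ENNReal.ofReal (Real.exp (-α.real Set.univ) / k.factorial) • addPoints α k)
      Set.univ = ENNReal.ofReal (Real.exp (-α.real Set.univ) / k.factorial *
        α.real Set.univ ^ k) := by
    rw [Measure.smul_apply, smul_eq_mul, ENNReal.ofReal_mul (by positivity), ← addPoints_real_univ,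
      ofReal_measureReal]
  simp_rw [h]
  rw [← ENNReal.ofReal_tsum_of_nonneg (fun k => by positivity) (hasSum_exp_factorial _).summable,
    (hasSum_exp_factorial _).tsum_eq, ENNReal.ofReal_one]

lemma hasSum_integral_poissonLaw [CompleteSpace F] {Φ : Finset (Pt d) → F}
    (hΦ : StronglyMeasurable Φ) {C : ℝ} (hC : ∀ s, ‖Φ s‖ ≤ C) :
    HasSum (fun k : ℕ => (Real.exp (-α.real Set.univ) / k.factorial) • ∫ s, Φ s ∂(addPoints α k))
      (∫ s, Φ s ∂(poissonLaw α)) := by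
  have hi : Integrable Φ (poissonLaw α) := integrable_of_bounded hΦ hC
  have h := hasSum_integral_measure hi
  have e (k : ℕ) : 0 ≤ Real.exp (-α.real Set.univ) / k.factorial := by positivity
  simp only [integral_smul_measure, ENNReal.toReal_ofReal (e _)] at h
  exact h

lemma sum_weighted_indicator {k : ℕ} (A : Fin k → Set (Pt d)) (t : Fin k → ℝ) (s : Finset (Pt d)) :
    ∑ x ∈ s, ∑ j, t j * (A j).indicator (fun _ => (1 : ℝ)) x = ∑ j, t j * ptCount (A j) s := by
  rw [Finset.sum_comm]
  simp only [ptCount_eq_sum, Finset.mul_sum]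

open Classical in
/-- A weighted count is a sum over the points, so adding an independent point multiplies its
characteristic function by a constant. -/
lemma integral_exp_addPoints [NullSingletonClass α] {k : ℕ} {A : Fin k → Set (Pt d)}
    (hA : ∀ j, MeasurableSet (A j)) (t : Fin k → ℝ) (n : ℕ) :
    ∫ s, Complex.exp ((∑ j, t j * ptCount (A j) s : ℝ) * Complex.I) ∂(addPoints α n) =
      (∫ x, Complex.exp ((∑ j, t j * (A j).indicator (fun _ => (1 : ℝ)) x : ℝ) * Complex.I) ∂α)
        ^ n := by
  have hm : Measurable fun s : Finset (Pt d) =>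
      Complex.exp ((∑ j, t j * ptCount (A j) s : ℝ) * Complex.I) := by
    have : Measurable fun s : Finset (Pt d) => ∑ j, t j * ptCount (A j) s :=
      Finset.measurable_fun_sum _ fun j _ => (measurable_ptCount (hA j)).const_mul _
    fun_prop
  induction n with
  | zero =>
    rw [addPoints, integral_dirac' _ _ hm.stronglyMeasurable]
    simp [ptCount]
  | succ n ih =>
    rw [integral_addPoints_succ hm.stronglyMeasurable (C := 1)
      (fun s => (Complex.norm_exp_ofReal_mul_I _).le)]
    rw [pow_succ', ← ih, ← integral_const_mul]
    congr 1 with s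
    rw [← integral_mul_const]
    refine integral_congr_ae ?_
    -- the measure `α` has no atoms, so that the new point is almost surely not yet in `s`
    have hs : ∀ᵐ x ∂α, x ∉ s := by
      have : α (s : Set (Pt d)) = 0 := s.finite_toSet.measure_zero α
      exact measure_eq_zero_iff_ae_notMem.1 this
    filter_upwards [hs] with x hx
    rw [← sum_weighted_indicator, ← sum_weighted_indicator, Finset.sum_insert hx, ← Complex.exp_add]
    push_cast
    ring_nf

lemma integral_exp_poissonLaw [NullSingletonClass α] {k : ℕ} {A : Fin k → Set (Pt d)}
    (hA : ∀ j, MeasurableSet (A j)) (t : Fin k → ℝ) :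
    ∫ s, Complex.exp ((∑ j, t j * ptCount (A j) s : ℝ) * Complex.I) ∂(poissonLaw α) =
      Complex.exp (∫ x, (Complex.exp
        ((∑ j, t j * (A j).indicator (fun _ => (1 : ℝ)) x : ℝ) * Complex.I) - 1) ∂α) := by
  have hm : Measurable fun s : Finset (Pt d) =>
      Complex.exp ((∑ j, t j * ptCount (A j) s : ℝ) * Complex.I) := by
    have : Measurable fun s : Finset (Pt d) => ∑ j, t j * ptCount (A j) s :=
      Finset.measurable_fun_sum _ fun j _ => (measurable_ptCount (hA j)).const_mul _
    fun_prop
  have hm' : Measurable fun x : Pt d =>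
      Complex.exp ((∑ j, t j * (A j).indicator (fun _ => (1 : ℝ)) x : ℝ) * Complex.I) := by
    have : Measurable fun x : Pt d => ∑ j, t j * (A j).indicator (fun _ => (1 : ℝ)) x :=
      Finset.measurable_fun_sum _ fun j _ => (measurable_const.indicator (hA j)).const_mul _
    fun_prop
  have h := hasSum_integral_poissonLaw (α := α) hm.stronglyMeasurable (C := 1)
      (fun s => (Complex.norm_exp_ofReal_mul_I _).le)
  simp_rw [integral_exp_addPoints hA] at h
  refine h.unique ?_
  rw [integral_sub (integrable_of_bounded hm'.stronglyMeasurable (C := 1)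
      (fun s => (Complex.norm_exp_ofReal_mul_I _).le)) (integrable_const _)]
  set z := ∫ x, Complex.exp
    ((∑ j, t j * (A j).indicator (fun _ => (1 : ℝ)) x : ℝ) * Complex.I) ∂α with hz
  have h2 := (NormedSpace.expSeries_div_hasSum_exp z).mul_left
    (Complex.exp (-(α.real Set.univ : ℂ)))
  rw [← Complex.exp_eq_exp_ℂ, ← Complex.exp_add] at h2
  have e1 : z - ∫ _, (1 : ℂ) ∂α = -(α.real Set.univ : ℂ) + z := by
    simp; ring
  have e2 : (fun n : ℕ => (Real.exp (-α.real Set.univ) / n.factorial) • z ^ n) =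
      fun n : ℕ => Complex.exp (-(α.real Set.univ : ℂ)) * (z ^ n / n.factorial) := by
    funext n
    rw [Complex.real_smul]; push_cast; ring
  rw [e1, e2]
  exact h2

/-- Under the Poisson law, the counts of disjoint sets are independent Poisson variables. -/
lemma map_ptCount_poissonLaw [NullSingletonClass α] {k : ℕ} {A : Fin k → Set (Pt d)}
    (hA : ∀ j, MeasurableSet (A j)) (hd : Pairwise (fun i j => Disjoint (A i) (A j))) :
    (poissonLaw α).map (fun s j => ptCount (A j) s) =
      Measure.pi (fun j => (poissonMeasure (α (A j)).toNNReal).map (Nat.cast : ℕ → ℝ)) := by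
  have hm : Measurable (fun (s : Finset (Pt d)) j => ptCount (A j) s) :=
    measurable_pi_lambda _ fun j => measurable_ptCount (hA j)
  have : ∀ j, IsProbabilityMeasure
      ((poissonMeasure (α (A j)).toNNReal).map (Nat.cast : ℕ → ℝ)) :=
    fun j => Measure.isProbabilityMeasure_map (by fun_prop)
  have : IsProbabilityMeasure ((poissonLaw α).map (fun s j => ptCount (A j) s)) :=
    Measure.isProbabilityMeasure_map hm.aemeasurable
  rw [← charFun_eq_pi_iff]
  intro t
  rw [Measure.map_map (by fun_prop) hm, charFun_apply, integral_map
    (Measurable.comp (by fun_prop) hm).aemeasurable (by fun_prop)]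
  simp only [charFun_map_cast_poissonMeasure, Function.comp, PiLp.inner_apply, Real.inner_apply]
  have h := integral_exp_poissonLaw (α := α) hA (fun j => t j)
  simp only [mul_comm (ptCount _ _)]
  rw [h, ← Complex.exp_sum]
  congr 1
  have hpt (x : Pt d) : Complex.exp
        ((∑ j, t j * (A j).indicator (fun _ => (1 : ℝ)) x : ℝ) * Complex.I) - 1 =
      ∑ j, (A j).indicator (fun _ => Complex.exp (t j * Complex.I) - 1) x := by
    by_cases hx : ∃ j, x ∈ A j
    · obtain ⟨j, hj⟩ := hx
      have hne (i : Fin k) (hi : i ≠ j) : x ∉ A i :=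
        fun hxi => Set.disjoint_left.1 (hd hi) hxi hj
      rw [Finset.sum_eq_single j (fun i _ hi => by simp [hne i hi]) (by simp),
        Finset.sum_eq_single j (fun i _ hi => by simp [hne i hi]) (by simp)]
      simp [hj]
    · push Not at hx
      simp [hx]
  simp_rw [hpt]
  rw [integral_finsetSum _ fun j _ => (integrable_const _).indicator (hA j)]
  refine Finset.sum_congr rfl fun j _ => ?_
  rw [integral_indicator_const _ (hA j), Complex.real_smul]
  rfl

end PoissonLaw

/-! ### The Poincaré inequality for the binomial chain and for bounded functionals -/

section BinomialChain

variable {d : ℕ}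

open Classical in
/-- The average of `Φ` over adding to `s` one point distributed according to `α`. -/
noncomputable def addAvg (α : Measure (Pt d)) (Φ : Finset (Pt d) → ℝ) (s : Finset (Pt d)) : ℝ :=
  ∫ x, Φ (insert x s) ∂α

/-- One step of the binomial chain: a point is added with probability `q * α(ℝ^d)`. -/
noncomputable def chainStep (α : Measure (Pt d)) (q : ℝ) (Φ : Finset (Pt d) → ℝ)
    (s : Finset (Pt d)) : ℝ :=
  (1 - q * α.real Set.univ) * Φ s + q * addAvg α Φ s

/-- The squared gradient `∫ (D_x Φ)² α(dx)`. -/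
noncomputable def sqGrad (α : Measure (Pt d)) (Φ : Finset (Pt d) → ℝ) (s : Finset (Pt d)) : ℝ :=
  ∫ x, addOneCost Φ x s ^ 2 ∂α

open Classical in
/-- The law of the binomial chain after `n` steps: each step adds a point with distribution
proportional to `α` with probability `q * α(ℝ^d)`, and does nothing otherwise. -/
noncomputable def binomialLaw (α : Measure (Pt d)) (q : ℝ) : ℕ → Measure (Finset (Pt d))
  | 0 => Measure.dirac ∅
  | n + 1 => ENNReal.ofReal (1 - q * α.real Set.univ) • binomialLaw α q n +
      ENNReal.ofReal q • (α.prod (binomialLaw α q n)).map (fun p => insert p.1 p.2)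

/-- A bounded measurable functional of finite sets. -/
def BddMeas (Φ : Finset (Pt d) → ℝ) : Prop := Measurable Φ ∧ ∃ C, ∀ s, |Φ s| ≤ C

variable {α : Measure (Pt d)} [IsFiniteMeasure α] {Φ : Finset (Pt d) → ℝ} {q : ℝ}

instance isFiniteMeasure_binomialLaw (n : ℕ) : IsFiniteMeasure (binomialLaw α q n) := by
  induction n with
  | zero => rw [binomialLaw]; infer_instance
  | succ n ih =>
    rw [binomialLaw]
    have (c : ℝ) (m : Measure (Finset (Pt d))) [IsFiniteMeasure m] :
        IsFiniteMeasure (ENNReal.ofReal c • m) := m.smul_finite ENNReal.ofReal_ne_top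
    infer_instance

lemma BddMeas.integrable (h : BddMeas Φ) {m : Measure (Finset (Pt d))} [IsFiniteMeasure m] :
    Integrable Φ m := by
  obtain ⟨hm, C, hC⟩ := h
  exact integrable_of_bounded hm.stronglyMeasurable hC

open Classical in
lemma BddMeas.measurable_insert (h : BddMeas Φ) (s : Finset (Pt d)) :
    Measurable (fun x => Φ (insert x s)) :=
  h.1.comp (PoissonCLT.measurable_insert.comp measurable_prodMk_right)

open Classical in
lemma BddMeas.integrable_insert (h : BddMeas Φ) (s : Finset (Pt d)) :
    Integrable (fun x => Φ (insert x s)) α := by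
  obtain ⟨C, hC⟩ := h.2
  exact integrable_of_bounded (h.measurable_insert s).stronglyMeasurable (fun _ => hC _)

lemma BddMeas.add {Ψ : Finset (Pt d) → ℝ} (h : BddMeas Φ) (h' : BddMeas Ψ) :
    BddMeas (fun s => Φ s + Ψ s) := by
  obtain ⟨C, hC⟩ := h.2
  obtain ⟨C', hC'⟩ := h'.2
  exact ⟨h.1.add h'.1, C + C', fun s => (abs_add_le _ _).trans (add_le_add (hC s) (hC' s))⟩

lemma BddMeas.const_mul (h : BddMeas Φ) (c : ℝ) : BddMeas (fun s => c * Φ s) := by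
  obtain ⟨C, hC⟩ := h.2
  exact ⟨h.1.const_mul c, |c| * C, fun s => by
    rw [abs_mul]; exact mul_le_mul_of_nonneg_left (hC s) (abs_nonneg c)⟩

lemma BddMeas.sq (h : BddMeas Φ) : BddMeas (fun s => Φ s ^ 2) := by
  obtain ⟨C, hC⟩ := h.2
  exact ⟨h.1.pow_const 2, C ^ 2, fun s => by
    rw [abs_pow]; exact pow_le_pow_left₀ (abs_nonneg _) (hC s) 2⟩

open Classical in
lemma BddMeas.addAvg (h : BddMeas Φ) : BddMeas (addAvg α Φ) := by
  obtain ⟨C, hC⟩ := h.2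
  refine ⟨?_, C * α.real Set.univ, fun s => ?_⟩
  · have h1 : StronglyMeasurable (fun p : Finset (Pt d) × Pt d => Φ (insert p.2 p.1)) :=
      (h.1.comp (PoissonCLT.measurable_insert.comp measurable_swap)).stronglyMeasurable
    exact (h1.integral_prod_right' (ν := α)).measurable
  · exact norm_integral_le_of_norm_le_const (μ := α) (f := fun x => Φ (insert x s))
      (ae_of_all _ fun x => hC _)

lemma BddMeas.chainStep (h : BddMeas Φ) : BddMeas (chainStep α q Φ) :=
  (h.const_mul _).add (h.addAvg.const_mul _)

open Classical in
lemma bddMeas_addOneCost (h : BddMeas Φ) (x : Pt d) : BddMeas (addOneCost Φ x) := by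
  obtain ⟨C, hC⟩ := h.2
  exact ⟨measurable_addOneCost h.1 x, C + C, fun s =>
    (abs_sub _ _).trans (add_le_add (hC _) (hC s))⟩

open Classical in
lemma BddMeas.sqGrad (h : BddMeas Φ) : BddMeas (sqGrad α Φ) := by
  obtain ⟨C, hC⟩ := h.2
  refine ⟨?_, (C + C) ^ 2 * α.real Set.univ, fun s => ?_⟩
  · have h1 : StronglyMeasurable (fun p : Finset (Pt d) × Pt d => addOneCost Φ p.2 p.1 ^ 2) :=
      (((measurable_addOneCost_uncurry h.1).comp measurable_swap).pow_const 2).stronglyMeasurable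
    exact (h1.integral_prod_right' (ν := α)).measurable
  · refine norm_integral_le_of_norm_le_const (μ := α) (f := fun x => addOneCost Φ x s ^ 2)
      (ae_of_all _ fun x => ?_)
    rw [norm_pow]
    exact pow_le_pow_left₀ (norm_nonneg _)
      ((abs_sub _ _).trans (add_le_add (hC _) (hC s))) 2

lemma integral_binomialLaw_succ (h : BddMeas Φ) (hq : 0 ≤ q) (hq1 : q * α.real Set.univ ≤ 1)
    (n : ℕ) :
    ∫ s, Φ s ∂(binomialLaw α q (n + 1)) = ∫ s, chainStep α q Φ s ∂(binomialLaw α q n) := by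
  obtain ⟨C, hC⟩ := h.2
  have hf (c : ℝ) (m : Measure (Finset (Pt d))) [IsFiniteMeasure m] :
      IsFiniteMeasure (ENNReal.ofReal c • m) := m.smul_finite ENNReal.ofReal_ne_top
  rw [binomialLaw, integral_add_measure h.integrable h.integrable, integral_smul_measure,
    integral_smul_measure, ENNReal.toReal_ofReal hq, ENNReal.toReal_ofReal (by linarith),
    integral_map_insert h.1.stronglyMeasurable hC, smul_eq_mul, smul_eq_mul,
    ← integral_const_mul, ← integral_const_mul, ← integral_add]
  · rfl
  · exact (h.const_mul _).integrable
  · exact (h.addAvg.const_mul _).integrable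

lemma integral_addPoints_chainStep (h : BddMeas Φ) (k : ℕ) :
    ∫ s, chainStep α q Φ s ∂(addPoints α k) =
      (1 - q * α.real Set.univ) * ∫ s, Φ s ∂(addPoints α k) +
        q * ∫ s, Φ s ∂(addPoints α (k + 1)) := by
  obtain ⟨C, hC⟩ := h.2
  rw [integral_addPoints_succ h.1.stronglyMeasurable hC, ← integral_const_mul,
    ← integral_const_mul, ← integral_add]
  · rfl
  · exact (h.const_mul _).integrable
  · exact (h.addAvg.const_mul _).integrable

/-- The binomial chain conditioned on its number of points. -/
lemma integral_binomialLaw (hq : 0 ≤ q) (hq1 : q * α.real Set.univ ≤ 1) (n : ℕ) :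
    ∀ {Φ : Finset (Pt d) → ℝ}, BddMeas Φ → ∫ s, Φ s ∂(binomialLaw α q n) =
      ∑ k ∈ Finset.range (n + 1), (n.choose k : ℝ) *
        (q ^ k * (1 - q * α.real Set.univ) ^ (n - k) * ∫ s, Φ s ∂(addPoints α k)) := by
  induction n with
  | zero => intro Φ h; simp [binomialLaw, addPoints]
  | succ n ih =>
    intro Φ h
    rw [integral_binomialLaw_succ h hq hq1, ih h.chainStep]
    rw [Finset.sum_choose_succ_mul (fun i j =>
      q ^ i * (1 - q * α.real Set.univ) ^ j * ∫ s, Φ s ∂(addPoints α i)), ← Finset.sum_add_distrib]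
    refine Finset.sum_congr rfl fun k hk => ?_
    have hkn : k ≤ n := Nat.lt_succ_iff.1 (Finset.mem_range.1 hk)
    rw [integral_addPoints_chainStep h, Nat.succ_sub hkn, pow_succ _ (n - k)]
    ring

/-- The Poisson limit theorem, tested against bounded functionals. -/
lemma tendsto_integral_binomialLaw {r : ℕ → ℝ} (hr0 : ∀ n, 0 ≤ r n) (hr1 : ∀ n : ℕ, n * r n ≤ 1)
    (hr : Tendsto (fun n : ℕ => n * r n) atTop (𝓝 1)) (h : BddMeas Φ) :
    Tendsto (fun n => ∫ s, Φ s ∂(binomialLaw α (r n) n)) atTop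
      (𝓝 (∫ s, Φ s ∂(poissonLaw α))) := by
  obtain ⟨C, hC⟩ := h.2
  set L := α.real Set.univ with hL
  have hL0 : 0 ≤ L := measureReal_nonneg
  have hr_zero : Tendsto r atTop (𝓝 0) := tendsto_zero_of_tendsto_mul_atTop hr
  have hsmall : ∀ᶠ n in atTop, r n * L ≤ 1 := by
    have : Tendsto (fun n => r n * L) atTop (𝓝 (0 * L)) := hr_zero.mul_const L
    rw [zero_mul] at this
    exact (this.eventually (Iio_mem_nhds one_pos)).mono fun n hn => le_of_lt hn
  rw [← (hasSum_integral_poissonLaw h.1.stronglyMeasurable hC).tsum_eq]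
  have key : Tendsto (fun n : ℕ => ∑' k : ℕ, (n.choose k : ℝ) *
        (r n ^ k * (1 - r n * L) ^ (n - k) * ∫ s, Φ s ∂(addPoints α k))) atTop
      (𝓝 (∑' k : ℕ, (Real.exp (-L) / k.factorial) • ∫ s, Φ s ∂(addPoints α k))) := by
    refine tendsto_tsum_of_dominated_convergence
      (bound := fun k : ℕ => C * (L ^ k / k.factorial)) ?_ ?_ ?_
    · exact (Real.summable_pow_div_factorial L).mul_left C
    · intro k
      have h1 := tendsto_choose_mul_pow_atTop k hr
      have h2 : Tendsto (fun n => (1 - r n * L) ^ (n - k)) atTop (𝓝 (Real.exp (-L))) := by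
        have e1 : Tendsto (fun n => (1 - r n * L) ^ n) atTop (𝓝 (Real.exp (-L))) := by
          have := Real.tendsto_one_add_pow_exp_of_tendsto (g := fun n => -(r n * L)) (t := -L) (by
            have := (hr.mul_const L).neg
            rw [one_mul] at this
            refine this.congr fun n => ?_
            ring)
          simpa [sub_eq_add_neg] using this
        have e2 : Tendsto (fun n => (1 - r n * L) ^ k) atTop (𝓝 1) := by
          have : Tendsto (fun n => (1 - r n * L) ^ k) atTop (𝓝 ((1 - 0 * L) ^ k)) :=
            ((tendsto_const_nhds).sub (hr_zero.mul_const L)).pow k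
          simpa using this
        have e3 := e1.div e2 one_ne_zero
        rw [div_one] at e3
        refine e3.congr' ?_
        have hpos : ∀ᶠ n in atTop, r n * L < 1 := by
          have : Tendsto (fun n => r n * L) atTop (𝓝 (0 * L)) := hr_zero.mul_const L
          rw [zero_mul] at this
          exact this.eventually (Iio_mem_nhds one_pos)
        filter_upwards [hpos, eventually_ge_atTop k] with n hn hk
        rw [Pi.div_apply, pow_sub₀ _ (by linarith) hk, div_eq_mul_inv]
      have h3 := (h1.mul h2).mul_const (∫ s, Φ s ∂(addPoints α k))
      rw [smul_eq_mul]
      convert h3 using 1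
      · funext n; ring
      · rw [one_pow]; ring_nf
    · filter_upwards [hsmall] with n hn k
      have hn0 : 0 ≤ 1 - r n * L := by linarith
      have hp1 : (1 - r n * L) ^ (n - k) ≤ 1 :=
        pow_le_one₀ hn0 (by nlinarith [mul_nonneg (hr0 n) hL0])
      have hc : (n.choose k : ℝ) * r n ^ k ≤ 1 / k.factorial := by
        calc (n.choose k : ℝ) * r n ^ k ≤ n ^ k / k.factorial * r n ^ k :=
              mul_le_mul_of_nonneg_right (Nat.choose_le_pow_div k n) (pow_nonneg (hr0 n) k)
          _ = (n * r n) ^ k / k.factorial := by rw [mul_pow]; ring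
          _ ≤ 1 / k.factorial := by
              gcongr
              exact pow_le_one₀ (mul_nonneg n.cast_nonneg (hr0 n)) (hr1 n)
      have hb := norm_integral_addPoints_le (α := α) (Φ := Φ) hC k
      rw [norm_mul, norm_mul, norm_mul, Real.norm_of_nonneg (n.choose k).cast_nonneg,
        Real.norm_of_nonneg (pow_nonneg (hr0 n) k), Real.norm_of_nonneg (pow_nonneg hn0 _)]
      calc (n.choose k : ℝ) * (r n ^ k * (1 - r n * L) ^ (n - k) * ‖∫ s, Φ s ∂addPoints α k‖)
          = ((n.choose k : ℝ) * r n ^ k) * ((1 - r n * L) ^ (n - k)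
              * ‖∫ s, Φ s ∂addPoints α k‖) := by ring
        _ ≤ (1 / k.factorial) * (1 * (C * L ^ k)) := by
            refine mul_le_mul hc ?_ (by positivity) (by positivity)
            exact mul_le_mul hp1 hb (norm_nonneg _) zero_le_one
        _ = C * (L ^ k / k.factorial) := by ring
  refine key.congr' ?_
  filter_upwards [hsmall] with n hn
  rw [integral_binomialLaw (hr0 n) hn n h]
  refine tsum_eq_sum fun k hk => ?_
  have hk' : n < k := by simpa using hk
  simp [Nat.choose_eq_zero_of_lt hk']

/-- The variance produced by one step is at most `q` times the squared gradient. -/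
lemma chainStep_sq_sub_le (h : BddMeas Φ) (s : Finset (Pt d)) :
    chainStep α q (fun s => Φ s ^ 2) s - chainStep α q Φ s ^ 2 ≤ q * sqGrad α Φ s := by
  classical
  have e : sqGrad α Φ s = addAvg α (fun s => Φ s ^ 2) s - 2 * Φ s * addAvg α Φ s +
      Φ s ^ 2 * α.real Set.univ := by
    have e1 : sqGrad α Φ s =
        ∫ x, ((Φ (insert x s) ^ 2 - 2 * Φ s * Φ (insert x s)) + Φ s ^ 2) ∂α := by
      unfold sqGrad addOneCost
      congr 1 with x
      ring
    rw [e1, integral_add, integral_sub, integral_const_mul, integral_const, smul_eq_mul]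
    · rw [addAvg, addAvg]; ring
    · exact h.sq.integrable_insert s
    · exact (h.integrable_insert s).const_mul _
    · exact (h.sq.integrable_insert s).sub ((h.integrable_insert s).const_mul _)
    · exact integrable_const _
  rw [e]
  unfold chainStep
  nlinarith [sq_nonneg (q * (addAvg α Φ s - Φ s * α.real Set.univ))]

/-- Jensen's inequality for one step of the chain. -/
lemma chainStep_sq_le (hq : 0 ≤ q) (hq1 : q * α.real Set.univ ≤ 1) (h : BddMeas Φ)
    (s : Finset (Pt d)) :
    chainStep α q Φ s ^ 2 ≤ chainStep α q (fun s => Φ s ^ 2) s := by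
  classical
  set e := chainStep α q Φ s with he
  have e1 : ∫ x, (Φ (insert x s) - e) ^ 2 ∂α =
      addAvg α (fun s => Φ s ^ 2) s - 2 * e * addAvg α Φ s + e ^ 2 * α.real Set.univ := by
    have e1 : ∫ x, (Φ (insert x s) - e) ^ 2 ∂α =
        ∫ x, ((Φ (insert x s) ^ 2 - 2 * e * Φ (insert x s)) + e ^ 2) ∂α := by
      congr 1 with x
      ring
    rw [e1, integral_add, integral_sub, integral_const_mul, integral_const, smul_eq_mul]
    · rw [addAvg, addAvg]; ring
    · exact h.sq.integrable_insert s
    · exact (h.integrable_insert s).const_mul _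
    · exact (h.sq.integrable_insert s).sub ((h.integrable_insert s).const_mul _)
    · exact integrable_const _
  have e2 : 0 ≤ ∫ x, (Φ (insert x s) - e) ^ 2 ∂α := integral_nonneg fun x => sq_nonneg _
  have e3 : 0 ≤ (1 - q * α.real Set.univ) * (Φ s - e) ^ 2 +
      q * ∫ x, (Φ (insert x s) - e) ^ 2 ∂α :=
    add_nonneg (mul_nonneg (by linarith) (sq_nonneg _)) (mul_nonneg hq e2)
  rw [e1] at e3
  have e4 : e = (1 - q * α.real Set.univ) * Φ s + q * addAvg α Φ s := he
  have e5 : (1 - q * α.real Set.univ) * (Φ s - e) ^ 2 + q * (addAvg α (fun s => Φ s ^ 2) s -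
      2 * e * addAvg α Φ s + e ^ 2 * α.real Set.univ) =
      chainStep α q (fun s => Φ s ^ 2) s - 2 * e * ((1 - q * α.real Set.univ) * Φ s +
        q * addAvg α Φ s) + e ^ 2 := by
    unfold chainStep; ring
  rw [e5, ← e4] at e3
  nlinarith

/-- The add-one cost commutes with the step of the chain. -/
lemma addOneCost_chainStep (h : BddMeas Φ) (x : Pt d) (s : Finset (Pt d)) :
    addOneCost (chainStep α q Φ) x s = chainStep α q (addOneCost Φ x) s := by
  classical
  have e : addAvg α (addOneCost Φ x) s = addAvg α Φ (insert x s) - addAvg α Φ s := by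
    unfold addAvg addOneCost
    rw [← integral_sub (h.integrable_insert _) (h.integrable_insert _)]
    congr 1 with y
    rw [Finset.insert_comm]
  unfold addOneCost at e ⊢
  unfold chainStep
  rw [e]
  ring

lemma sqGrad_chainStep_le (hq : 0 ≤ q) (hq1 : q * α.real Set.univ ≤ 1) (h : BddMeas Φ)
    (s : Finset (Pt d)) : sqGrad α (chainStep α q Φ) s ≤ chainStep α q (sqGrad α Φ) s := by
  classical
  obtain ⟨C, hC⟩ := h.2
  have hD : ∀ x s, |addOneCost Φ x s ^ 2| ≤ (C + C) ^ 2 := fun x s => by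
    rw [abs_pow]
    exact pow_le_pow_left₀ (abs_nonneg _) ((abs_sub _ _).trans (add_le_add (hC _) (hC s))) 2
  have hDm : Measurable (fun p : Pt d × Finset (Pt d) => addOneCost Φ p.1 p.2 ^ 2) :=
    (measurable_addOneCost_uncurry h.1).pow_const 2
  have hint1 : Integrable (fun p : Pt d × Pt d => addOneCost Φ p.1 (insert p.2 s) ^ 2)
      (α.prod α) := by
    refine integrable_of_bounded (Measurable.stronglyMeasurable ?_) (fun _ => hD _ _)
    exact hDm.comp (measurable_fst.prodMk
      (measurable_insert.comp (measurable_snd.prodMk measurable_const)))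
  have hint0 : Integrable (fun x => addOneCost Φ x s ^ 2) α :=
    integrable_of_bounded (hDm.comp measurable_prodMk_right).stronglyMeasurable (fun _ => hD _ _)
  have e : chainStep α q (sqGrad α Φ) s =
      ∫ x, chainStep α q (fun s => addOneCost Φ x s ^ 2) s ∂α := by
    unfold chainStep
    rw [integral_add, integral_const_mul, integral_const_mul]
    · unfold addAvg sqGrad
      rw [integral_integral_swap (f := fun y x => addOneCost Φ x (insert y s) ^ 2) hint1.swap]
    · exact hint0.const_mul _
    · exact hint1.integral_prod_left.const_mul _
  rw [e]
  unfold sqGrad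
  refine integral_mono_of_nonneg (ae_of_all _ fun x => sq_nonneg _) ?_ (ae_of_all _ fun x => ?_)
  · exact (hint0.const_mul _).add (hint1.integral_prod_left.const_mul _)
  · simp only [addOneCost_chainStep h]
    exact chainStep_sq_le hq hq1 (bddMeas_addOneCost h x) s

/-- The Efron–Stein inequality for the binomial chain. The induction applies the bound for `n` steps
to `chainStep α q Φ`, which turns `n` steps into `n + 1` steps. -/
lemma variance_binomialLaw_le (hq : 0 ≤ q) (hq1 : q * α.real Set.univ ≤ 1) (n : ℕ) :
    ∀ {Φ : Finset (Pt d) → ℝ}, BddMeas Φ →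
      ∫ s, Φ s ^ 2 ∂(binomialLaw α q (n + 1)) - (∫ s, Φ s ∂(binomialLaw α q (n + 1))) ^ 2 ≤
        ((n + 1 : ℕ) * q) * ∫ s, sqGrad α Φ s ∂(binomialLaw α q n) := by
  have step (n : ℕ) {Φ : Finset (Pt d) → ℝ} (h : BddMeas Φ) :
      ∫ s, Φ s ^ 2 ∂(binomialLaw α q (n + 1)) ≤ ∫ s, chainStep α q Φ s ^ 2 ∂(binomialLaw α q n) +
        q * ∫ s, sqGrad α Φ s ∂(binomialLaw α q n) := by
    rw [integral_binomialLaw_succ h.sq hq hq1, ← integral_const_mul,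
      ← integral_add h.chainStep.sq.integrable (h.sqGrad.const_mul _).integrable]
    refine integral_mono h.sq.chainStep.integrable
      (h.chainStep.sq.add (h.sqGrad.const_mul _)).integrable fun s => ?_
    have := chainStep_sq_sub_le (α := α) (q := q) h s
    linarith
  induction n with
  | zero =>
    intro Φ h
    have h1 := step 0 h
    rw [integral_binomialLaw_succ h hq hq1]
    have h2 : ∫ s, chainStep α q Φ s ^ 2 ∂(binomialLaw α q 0) =
        (∫ s, chainStep α q Φ s ∂(binomialLaw α q 0)) ^ 2 := by
      rw [binomialLaw, integral_dirac' _ _ h.chainStep.sq.1.stronglyMeasurable,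
        integral_dirac' _ _ h.chainStep.1.stronglyMeasurable]
    rw [h2] at h1
    push_cast
    linarith
  | succ n ih =>
    intro Φ h
    have h1 := step (n + 1) h
    have h2 := ih (Φ := chainStep α q Φ) h.chainStep
    rw [integral_binomialLaw_succ h hq hq1]
    have h3 : ∫ s, sqGrad α (chainStep α q Φ) s ∂(binomialLaw α q n) ≤
        ∫ s, sqGrad α Φ s ∂(binomialLaw α q (n + 1)) := by
      rw [integral_binomialLaw_succ h.sqGrad hq hq1]
      exact integral_mono h.chainStep.sqGrad.integrable h.sqGrad.chainStep.integrable
        (sqGrad_chainStep_le hq hq1 h)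
    have h4 := mul_le_mul_of_nonneg_left h3 (show 0 ≤ ((n + 1 : ℕ) : ℝ) * q by positivity)
    push_cast at *
    linarith

/-- The Poincaré inequality of the Poisson process, for bounded functionals. -/
lemma variance_poissonLaw_le_of_bounded (h : BddMeas Φ) :
    ∫ s, Φ s ^ 2 ∂(poissonLaw α) - (∫ s, Φ s ∂(poissonLaw α)) ^ 2 ≤
      ∫ s, sqGrad α Φ s ∂(poissonLaw α) := by
  -- with `q = 1 / (n + 1)`, the laws of the chain after `n` and after `n + 1` steps have the
  -- same limit
  have hlim : Tendsto (fun n : ℕ => (n : ℝ) * (1 / ((n : ℝ) + 1))) atTop (𝓝 1) := by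
    simpa [div_eq_mul_inv] using tendsto_natCast_div_add_atTop (1 : ℝ)
  have hlim' : Tendsto (fun n : ℕ => (n : ℝ) * (1 / (n : ℝ))) atTop (𝓝 1) := by
    refine tendsto_const_nhds.congr' ?_
    filter_upwards [eventually_gt_atTop 0] with n hn
    field_simp
  have hA : Tendsto (fun n : ℕ => ∫ s, sqGrad α Φ s ∂(binomialLaw α (1 / ((n : ℝ) + 1)) n)) atTop
      (𝓝 (∫ s, sqGrad α Φ s ∂(poissonLaw α))) := by
    refine tendsto_integral_binomialLaw (fun n => by positivity) (fun n => ?_) hlim h.sqGrad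
    rw [mul_one_div, div_le_one (by positivity)]; linarith
  have hB {Ψ : Finset (Pt d) → ℝ} (hΨ : BddMeas Ψ) :
      Tendsto (fun n : ℕ => ∫ s, Ψ s ∂(binomialLaw α (1 / ((n : ℝ) + 1)) (n + 1))) atTop
      (𝓝 (∫ s, Ψ s ∂(poissonLaw α))) := by
    have := tendsto_integral_binomialLaw (α := α) (r := fun n => 1 / (n : ℝ))
      (fun n => by positivity) (fun n => ?_) hlim' hΨ
    · have h2 := this.comp (tendsto_add_atTop_nat 1)
      simpa [Function.comp_def] using h2
    · rcases Nat.eq_zero_or_pos n with rfl | hn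
      · simp
      · rw [mul_one_div, div_self (by positivity)]
  refine le_of_tendsto_of_tendsto ((hB h.sq).sub ((hB h).pow 2)) hA ?_
  have hz : Tendsto (fun n : ℕ => 1 / ((n : ℝ) + 1) * α.real Set.univ) atTop (𝓝 0) := by
    simpa using tendsto_one_div_add_atTop_nhds_zero_nat.mul_const (α.real Set.univ)
  filter_upwards [hz.eventually (Iio_mem_nhds one_pos)] with n hn
  have := variance_binomialLaw_le (α := α) (q := 1 / ((n : ℝ) + 1))
    (by positivity) (le_of_lt hn) n h
  have e : ((n + 1 : ℕ) : ℝ) * (1 / ((n : ℝ) + 1)) = 1 := by push_cast; field_simp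
  rwa [e, one_mul] at this

end BinomialChain

/-! ### The Poincaré inequality for the Poisson law -/

section Poincare

lemma enorm_sq_eq_ofReal (x : ℝ) : ‖x‖ₑ ^ 2 = ENNReal.ofReal (x ^ 2) := by
  rw [Real.enorm_eq_ofReal_abs, ← ENNReal.ofReal_pow (abs_nonneg x), sq_abs]

section General

variable {X : Type*} [MeasurableSpace X] {m : Measure X} [IsProbabilityMeasure m]

/-- Twice the variance is the mean squared difference of two independent copies. -/
lemma lintegral_lintegral_sub_sq {f : X → ℝ} (hf : MemLp f 2 m) :
    ∫⁻ s, ∫⁻ t, ‖f s - f t‖ₑ ^ 2 ∂m ∂m = 2 * ENNReal.ofReal Var[f; m] := by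
  have hi : Integrable f m := hf.integrable one_le_two
  have hi2 : Integrable (fun s => f s ^ 2) m := hf.integrable_sq
  have hin (s : X) : Integrable (fun t => (f s - f t) ^ 2) m :=
    ((memLp_const (f s)).sub hf).integrable_sq
  have e1 (s : X) : ∫ t, (f s - f t) ^ 2 ∂m = f s ^ 2 - 2 * m[f] * f s + ∫ t, f t ^ 2 ∂m := by
    have : ∫ t, (f s - f t) ^ 2 ∂m = ∫ t, ((f s ^ 2 - (2 * f s) * f t) + f t ^ 2) ∂m := by
      congr 1 with t; ring
    rw [this, integral_add, integral_sub, integral_const_mul]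
    · simp; ring
    · exact integrable_const _
    · exact hi.const_mul _
    · exact (integrable_const _).sub (hi.const_mul _)
    · exact hi2
  have e2 (s : X) : ∫⁻ t, ‖f s - f t‖ₑ ^ 2 ∂m =
      ENNReal.ofReal (f s ^ 2 - 2 * m[f] * f s + ∫ t, f t ^ 2 ∂m) := by
    rw [← e1, ofReal_integral_eq_lintegral_ofReal (hin s) (ae_of_all _ fun t => sq_nonneg _)]
    simp only [enorm_sq_eq_ofReal]
  simp_rw [e2]
  rw [← ofReal_integral_eq_lintegral_ofReal]
  · have : (2 : ℝ≥0∞) = ENNReal.ofReal 2 := by simp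
    rw [integral_add, integral_sub, integral_const_mul, variance_eq_sub hf, this,
      ← ENNReal.ofReal_mul zero_le_two]
    · congr 1
      simp
      ring
    · exact hi2
    · exact hi.const_mul _
    · exact hi2.sub (hi.const_mul _)
    · exact integrable_const _
  · exact (hi2.sub (hi.const_mul _)).add (integrable_const _)
  · refine ae_of_all _ fun s => ?_
    simp only [Pi.zero_apply, ← e1]
    exact integral_nonneg fun t => sq_nonneg _

/-- A random variable whose truncations have bounded variance is square integrable. -/
lemma memLp_two_of_truncation {f : X → ℝ} (hf : Measurable f) {V : ℝ}
    (h : ∀ M : ℕ, Var[fun s => max (-(M : ℝ)) (min (M : ℝ) (f s)); m] ≤ V) :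
    MemLp f 2 m ∧ Var[f; m] ≤ V := by
  have hV : 0 ≤ V := (variance_nonneg _ _).trans (h 0)
  set g : ℕ → X → ℝ := fun M s => max (-(M : ℝ)) (min (M : ℝ) (f s)) with hg
  have hgm (M : ℕ) : Measurable (g M) := measurable_const.max (measurable_const.min hf)
  have hgL (M : ℕ) : MemLp (g M) 2 m := by
    refine MemLp.of_bound (hgm M).aestronglyMeasurable (M : ℝ) (ae_of_all _ fun s => ?_)
    rw [Real.norm_eq_abs, abs_le]
    exact ⟨le_max_left _ _, max_le (by linarith [(Nat.cast_nonneg M : (0 : ℝ) ≤ M)])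
      (min_le_left _ _)⟩
  have hlim (s : X) : Tendsto (fun M => g M s) atTop (𝓝 (f s)) := by
    refine tendsto_const_nhds.congr' ?_
    obtain ⟨N, hN⟩ := exists_nat_ge |f s|
    filter_upwards [eventually_ge_atTop N] with M hM
    have hM' : |f s| ≤ M := hN.trans (by exact_mod_cast hM)
    rw [abs_le] at hM'
    simp only [hg]
    rw [min_eq_right hM'.2, max_eq_right hM'.1]
  have hgv (M : ℕ) : Var[g M; m] ≤ V := h M
  clear_value g
  -- the double integral does not involve the means of the truncations, so that Fatou's lemma
  -- applies before integrability is known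
  have hF : ∫⁻ s, ∫⁻ t, ‖f s - f t‖ₑ ^ 2 ∂m ∂m ≤ 2 * ENNReal.ofReal V := by
    have hpt (s t : X) : ‖f s - f t‖ₑ ^ 2 = liminf (fun M => ‖g M s - g M t‖ₑ ^ 2) atTop := by
      refine (Tendsto.liminf_eq ?_).symm
      exact ENNReal.Tendsto.pow ((hlim s).sub (hlim t)).enorm
    have hm1 (M : ℕ) : Measurable (fun p : X × X => ‖g M p.1 - g M p.2‖ₑ ^ 2) :=
      (((hgm M).comp measurable_fst).sub ((hgm M).comp measurable_snd)).enorm.pow_const 2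
    have hm2 (s : X) (M : ℕ) : Measurable (fun t => ‖g M s - g M t‖ₑ ^ 2) :=
      (measurable_const.sub (hgm M)).enorm.pow_const 2
    have hm3 (M : ℕ) : Measurable (fun s => ∫⁻ t, ‖g M s - g M t‖ₑ ^ 2 ∂m) :=
      (hm1 M).lintegral_prod_right'
    have hvar (M : ℕ) : ∫⁻ s, ∫⁻ t, ‖g M s - g M t‖ₑ ^ 2 ∂m ∂m ≤ 2 * ENNReal.ofReal V := by
      rw [lintegral_lintegral_sub_sq (hgL M)]
      exact mul_le_mul_right (ENNReal.ofReal_le_ofReal (hgv M)) _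
    have h1 (s : X) : ∫⁻ t, ‖f s - f t‖ₑ ^ 2 ∂m ≤
        liminf (fun M : ℕ => ∫⁻ t, ‖g M s - g M t‖ₑ ^ 2 ∂m) atTop := by
      simp_rw [hpt s]
      exact lintegral_liminf_le (hm2 s)
    have h2 := lintegral_liminf_le (μ := m) (u := atTop) hm3
    have h3 : liminf (fun M : ℕ => ∫⁻ s, ∫⁻ t, ‖g M s - g M t‖ₑ ^ 2 ∂m ∂m) atTop ≤
        liminf (fun _ : ℕ => 2 * ENNReal.ofReal V) atTop :=
      liminf_le_liminf (Eventually.of_forall hvar)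
    rw [liminf_const] at h3
    exact (lintegral_mono h1).trans (h2.trans h3)
  have hmem : MemLp f 2 m := by
    have hm2 : Measurable (fun p : X × X => ‖f p.1 - f p.2‖ₑ ^ 2) :=
      ((hf.comp measurable_fst).sub (hf.comp measurable_snd)).enorm.pow_const 2
    have hfin : ∀ᵐ s ∂m, ∫⁻ t, ‖f s - f t‖ₑ ^ 2 ∂m < ∞ :=
      ae_lt_top hm2.lintegral_prod_right'
        (hF.trans_lt (ENNReal.mul_lt_top (by simp) ENNReal.ofReal_lt_top)).ne
    obtain ⟨s, hs⟩ := hfin.exists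
    have : MemLp (fun t => f s - f t) 2 m := by
      refine ⟨(measurable_const.sub hf).aestronglyMeasurable, ?_⟩
      rw [eLpNorm_lt_top_iff_lintegral_rpow_enorm_lt_top two_ne_zero ENNReal.ofNat_ne_top]
      simpa using hs
    have h2 := (memLp_const (μ := m) (p := 2) (f s)).sub this
    simpa [Pi.sub_def] using h2
  refine ⟨hmem, ?_⟩
  rw [lintegral_lintegral_sub_sq hmem] at hF
  rw [ENNReal.mul_le_mul_iff_right (by simp) (by simp)] at hF
  exact (ENNReal.ofReal_le_ofReal_iff hV).1 hF

end General

variable {d : ℕ} {α : Measure (Pt d)} [IsFiniteMeasure α]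

/-- **Poincaré inequality** for the Poisson process: the variance of a functional is at most the
integral of its mean squared add-one cost, and it is square integrable as soon as the latter is
finite. -/
theorem poincare_poissonLaw {G : Finset (Pt d) → ℝ} (hG : Measurable G)
    (hR : ∫⁻ x, ∫⁻ s, ‖addOneCost G x s‖ₑ ^ 2 ∂(poissonLaw α) ∂α < ∞) :
    MemLp G 2 (poissonLaw α) ∧
      Var[G; poissonLaw α] ≤ (∫⁻ x, ∫⁻ s, ‖addOneCost G x s‖ₑ ^ 2 ∂(poissonLaw α) ∂α).toReal := by
  refine memLp_two_of_truncation hG fun M => ?_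
  set g : Finset (Pt d) → ℝ := fun s => max (-(M : ℝ)) (min (M : ℝ) (G s)) with hg
  have hgm : Measurable g := measurable_const.max (measurable_const.min hG)
  have hgb : ∀ s, |g s| ≤ M := fun s => abs_le.2 ⟨le_max_left _ _,
    max_le (by linarith [(Nat.cast_nonneg M : (0 : ℝ) ≤ M)]) (min_le_left _ _)⟩
  have hb : BddMeas g := ⟨hgm, M, hgb⟩
  have hL : MemLp g 2 (poissonLaw α) :=
    MemLp.of_bound hgm.aestronglyMeasurable (M : ℝ) (ae_of_all _ hgb)
  -- truncation is a contraction, so that it does not increase the add-one cost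
  have hle (x : Pt d) (s : Finset (Pt d)) : |addOneCost g x s| ≤ |addOneCost G x s| := by
    unfold addOneCost
    simp only [hg]
    exact (abs_max_sub_max_le_max _ _ _ _).trans <| by
      rw [sub_self, abs_zero, max_eq_right (abs_nonneg _)]
      exact (abs_min_sub_min_le_max _ _ _ _).trans (by simp)
  rw [variance_eq_sub hL]
  refine (variance_poissonLaw_le_of_bounded hb).trans ?_
  rw [← ENNReal.ofReal_le_iff_le_toReal hR.ne,
    ofReal_integral_eq_lintegral_ofReal hb.sqGrad.integrable
      (ae_of_all _ fun s => integral_nonneg fun x => sq_nonneg _)]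
  have hm : Measurable (fun p : Pt d × Finset (Pt d) => ‖addOneCost G p.1 p.2‖ₑ ^ 2) :=
    (measurable_addOneCost_uncurry hG).enorm.pow_const 2
  rw [lintegral_lintegral_swap hm.aemeasurable]
  refine lintegral_mono fun s => ?_
  have hi : Integrable (fun x => addOneCost g x s ^ 2) α := by
    refine integrable_of_bounded (C := (M + M : ℝ) ^ 2) (Measurable.stronglyMeasurable
      (((measurable_addOneCost_uncurry hgm).pow_const 2).comp measurable_prodMk_right))
      (fun x => ?_)
    rw [norm_pow]
    exact pow_le_pow_left₀ (norm_nonneg _) ((abs_sub _ _).trans (add_le_add (hgb _) (hgb s))) 2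
  unfold sqGrad
  rw [ofReal_integral_eq_lintegral_ofReal hi (ae_of_all _ fun x => sq_nonneg _)]
  refine lintegral_mono fun x => ?_
  rw [enorm_sq_eq_ofReal]
  exact ENNReal.ofReal_le_ofReal (sq_le_sq.2 (hle x s))

end Poincare

/-! ### Restrictions of a homogeneous Poisson process to cubes -/

section Restriction

/-- Grouping independent random variables into independent families; the converse of
`iIndepFun_uncurry`. -/
lemma iIndepFun_curry {Ω ι : Type*} {mΩ : MeasurableSpace Ω} {P : Measure Ω}
    {κ : ι → Type*} {𝓧 : (i : ι) → κ i → Type*} {m𝓧 : ∀ i j, MeasurableSpace (𝓧 i j)}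
    {X : (i : ι) → (j : κ i) → Ω → 𝓧 i j} (mX : ∀ i j, Measurable (X i j))
    (h : iIndepFun (fun (p : (i : ι) × κ i) ω => X p.1 p.2 ω) P) :
    iIndepFun (fun i ω => (X i · ω)) P := by
  have := h.isProbabilityMeasure
  have : ∀ i j, IsProbabilityMeasure (P.map (X i j)) :=
    fun i j => Measure.isProbabilityMeasure_map (mX i j).aemeasurable
  have h2 (i : ι) : iIndepFun (X i) P :=
    h.precomp (g := fun j => (⟨i, j⟩ : (i : ι) × κ i)) sigma_mk_injective
  have e : (MeasurableEquiv.piCurry 𝓧) ∘ (fun ω p => X p.1 p.2 ω) = fun ω i j => X i j ω := by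
    ext; simp [Sigma.curry]
  rw [iIndepFun_iff_map_fun_eq_infinitePi_map (by fun_prop), ← e,
    ← Measure.map_map (by fun_prop) (by fun_prop),
    (iIndepFun_iff_map_fun_eq_infinitePi_map (by fun_prop)).1 h,
    Measure.infinitePi_map_piCurry (fun i j => P.map (X i j))]
  congrm Measure.infinitePi fun i => ?_
  rw [(iIndepFun_iff_map_fun_eq_infinitePi_map (by fun_prop)).1 (h2 i)]

variable {d : ℕ}

/-- The set of points that lie in exactly those `A i` with `i ∈ T`. -/
def atom {ι : Type*} (A : ι → Set (Pt d)) (T : Finset ι) : Set (Pt d) :=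
  {x | ∀ i, i ∈ T ↔ x ∈ A i}

section Atom

variable {ι : Type*} {A : ι → Set (Pt d)}

lemma measurableSet_atom [Finite ι] (hA : ∀ i, MeasurableSet (A i)) (T : Finset ι) :
    MeasurableSet (atom A T) := by
  classical
  have : atom A T = ⋂ i, if i ∈ T then A i else (A i)ᶜ := by
    ext x
    simp only [atom, Set.mem_ofPred_eq, Set.mem_iInter]
    refine forall_congr' fun i => ?_
    by_cases hi : i ∈ T <;> simp [hi]
  rw [this]
  refine MeasurableSet.iInter fun i => ?_
  split_ifs
  exacts [hA i, (hA i).compl]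

lemma disjoint_atom {S T : Finset ι} (h : S ≠ T) : Disjoint (atom A S) (atom A T) := by
  refine Set.disjoint_left.2 fun x hS hT => h ?_
  ext i
  rw [hS i, hT i]

lemma ptCount_eq_sum_atom [Fintype ι] [DecidableEq ι] (i : ι) (s : Finset (Pt d)) :
    ptCount (A i) s = ∑ T : Finset ι, if i ∈ T then ptCount (atom A T) s else 0 := by
  classical
  have (T : Finset ι) : (if i ∈ T then ptCount (atom A T) s else 0) =
      ∑ x ∈ s, if i ∈ T then (atom A T).indicator (fun _ => (1 : ℝ)) x else 0 := by
    split_ifs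
    · exact ptCount_eq_sum _ _
    · simp
  simp_rw [this]
  rw [Finset.sum_comm, ptCount_eq_sum]
  refine Finset.sum_congr rfl fun x _ => ?_
  have hx : x ∈ atom A (Finset.univ.filter fun i => x ∈ A i) := fun i => by simp
  rw [Finset.sum_eq_single (Finset.univ.filter fun i => x ∈ A i)]
  · rw [Set.indicator_of_mem hx]
    simp [Set.indicator_apply]
  · intro T _ hT
    have : x ∉ atom A T := fun h => Set.disjoint_left.1 (disjoint_atom hT) h hx
    simp [this]
  · simp

end Atom

/-- A law on finite sets is determined by the joint laws of the counts of disjoint sets. -/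
lemma ext_of_map_ptCount {m₁ m₂ : Measure (Finset (Pt d))} [IsFiniteMeasure m₁]
    [IsFiniteMeasure m₂]
    (h : ∀ (k : ℕ) (A : Fin k → Set (Pt d)), (∀ j, MeasurableSet (A j)) →
      Pairwise (fun i j => Disjoint (A i) (A j)) →
      m₁.map (fun s j => ptCount (A j) s) = m₂.map (fun s j => ptCount (A j) s)) :
    m₁ = m₂ := by
  classical
  -- a finite family of counts is a linear image of the counts of the disjoint atoms
  have key : m₁.map allCounts = m₂.map allCounts := by
    refine IsProjectiveLimit.unique (P := fun I => (m₁.map allCounts).map I.restrict)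
      (fun I => rfl) (fun I => ?_)
    beta_reduce
    let A : I → Set (Pt d) := fun j => j.1.1
    have hA (j : I) : MeasurableSet (A j) := j.1.2
    let e := Fintype.equivFin (Finset I)
    let B : Fin (Fintype.card (Finset I)) → Set (Pt d) := fun k => atom A (e.symm k)
    let L : (Fin (Fintype.card (Finset I)) → ℝ) → (I → ℝ) := fun c j =>
      ∑ T : Finset I, if j ∈ T then c (e T) else 0
    have hL : Measurable L := by
      refine measurable_pi_lambda _ fun j => Finset.measurable_fun_sum _ fun T _ => ?_
      split_ifs <;> fun_prop
    have hBm : Measurable (fun (s : Finset (Pt d)) k => ptCount (B k) s) :=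
      measurable_pi_lambda _ fun k => measurable_ptCount (measurableSet_atom hA _)
    have hfac : I.restrict ∘ allCounts (d := d) = L ∘ fun s k => ptCount (B k) s := by
      funext s j
      simp only [Function.comp, Finset.restrict, allCounts, L, B, Equiv.symm_apply_apply]
      exact ptCount_eq_sum_atom (A := A) j s
    have hB := h _ B (fun k => measurableSet_atom hA _)
      (fun i j hij => disjoint_atom (fun h => hij (e.symm.injective h)))
    rw [Measure.map_map (by fun_prop) measurable_allCounts,
      Measure.map_map (by fun_prop) measurable_allCounts, hfac, ← Measure.map_map hL hBm,
      ← Measure.map_map hL hBm, hB]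
  refine Measure.ext fun S hS => ?_
  rw [← comap_allCounts] at hS
  obtain ⟨S', hS', rfl⟩ := hS
  rw [← Measure.map_apply measurable_allCounts hS', key,
    Measure.map_apply measurable_allCounts hS']

/-- The intensity measure of the Poisson process of density `lam` restricted to a cube. -/
noncomputable def cubeIntensity (lam : ℝ≥0) (y : Pt d) (a : ℝ) : Measure (Pt d) :=
  lam • volume.restrict (cube y a)

instance (lam : ℝ≥0) (y : Pt d) (a : ℝ) : IsFiniteMeasure (cubeIntensity lam y a) := by
  have : IsFiniteMeasure (volume.restrict (cube y a)) :=
    isFiniteMeasure_restrict.2 (isBounded_cube y a).measure_lt_top.ne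
  unfold cubeIntensity
  infer_instance

instance [NeZero d] (lam : ℝ≥0) (y : Pt d) (a : ℝ) :
    NullSingletonClass (cubeIntensity lam y a) := by
  refine ⟨fun x => ?_⟩
  have : NullSingletonClass (volume : Measure (Pt d)) := inferInstance
  rw [cubeIntensity, Measure.smul_apply, measure_singleton, smul_zero]

section Poisson

variable {Ω : Type*} [MeasurableSpace Ω] {μ : Measure Ω} {lam : ℝ≥0} {P : Ω → Configuration d}

lemma iIndepFun_count (hP : IsHomogeneousPoisson lam P μ) {ι : Type*} [Finite ι]
    {A : ι → Set (Pt d)} (hA : ∀ i, MeasurableSet (A i))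
    (hd : Pairwise (fun i j => Disjoint (A i) (A j))) :
    iIndepFun (fun i ω => (P ω).count (A i)) μ := by
  have := Fintype.ofFinite ι
  have h := hP.iIndepFun_count (Fintype.card ι) (fun k => A ((Fintype.equivFin ι).symm k))
    (fun k => hA _) (fun i j hij => hd (fun h => hij ((Fintype.equivFin ι).symm.injective h)))
  have h2 := h.precomp (Fintype.equivFin ι).injective
  simpa using h2

lemma ptCount_inCube (φ : Configuration d) (y : Pt d) (a : ℝ) (A : Set (Pt d)) :
    ptCount A (φ.inCube y a) = ((φ.count (A ∩ cube y a)).toNat : ℝ) :=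
  ptCount_restrict _ _ _ _

lemma measurable_inCube_comp (hP : IsHomogeneousPoisson lam P μ) (y : Pt d) (a : ℝ) :
    Measurable (fun ω => (P ω).inCube y a) :=
  (measurable_inCube y a).comp hP.measurable

/-- The restriction of a homogeneous Poisson process to a cube has the Poisson law. -/
theorem map_inCube [NeZero d] [IsProbabilityMeasure μ] (hP : IsHomogeneousPoisson lam P μ)
    (y : Pt d) (a : ℝ) :
    μ.map (fun ω => (P ω).inCube y a) = poissonLaw (cubeIntensity lam y a) := by
  have hm := measurable_inCube_comp hP y a
  have : IsProbabilityMeasure (μ.map (fun ω => (P ω).inCube y a)) :=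
    Measure.isProbabilityMeasure_map hm.aemeasurable
  refine ext_of_map_ptCount fun k A hA hd => ?_
  rw [map_ptCount_poissonLaw hA hd, Measure.map_map
    (measurable_pi_lambda _ fun j => measurable_ptCount (hA j)) hm]
  simp only [Function.comp_def, ptCount_inCube]
  have hAW (j : Fin k) : MeasurableSet (A j ∩ cube y a) := (hA j).inter (measurableSet_cube y a)
  have hi := (iIndepFun_count hP hAW (fun i j hij =>
    (hd hij).mono Set.inter_subset_left Set.inter_subset_left)).comp
      (fun _ n => (n.toNat : ℝ)) (fun _ => measurable_from_top)
  have hmc (j : Fin k) : Measurable (fun ω => (P ω).count (A j ∩ cube y a)) :=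
    (measurable_count (hAW j)).comp hP.measurable
  have hi2 := (iIndepFun_iff_map_fun_eq_pi_map (fun j =>
    (measurable_from_top.comp (hmc j)).aemeasurable)).1 hi
  simp only [Function.comp_def] at hi2
  rw [hi2]
  congr 1
  funext j
  have hlaw := (hP.hasLaw_count _ (hAW j)
    ((isBounded_cube y a).subset Set.inter_subset_right)).map_eq
  have e1 : μ.map (fun ω => (((P ω).count (A j ∩ cube y a)).toNat : ℝ)) =
      (μ.map (fun ω => (P ω).count (A j ∩ cube y a))).map (fun n : ℕ∞ => (n.toNat : ℝ)) := by
    rw [Measure.map_map measurable_from_top (hmc j)]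
    rfl
  rw [e1, hlaw, Measure.map_map measurable_from_top measurable_from_top]
  congr 1
  congr 1
  rw [cubeIntensity, Measure.smul_apply, Measure.restrict_apply (hA j), ENNReal.smul_def,
    smul_eq_mul, ENNReal.toNNReal_mul, ENNReal.toNNReal_coe]

/-- The restrictions of a Poisson process to disjoint cubes are independent. -/
theorem iIndepFun_inCube (hP : IsHomogeneousPoisson lam P μ) {ι : Type*} {y : ι → Pt d} {a : ℝ}
    (hd : Pairwise (fun i j => Disjoint (cube (y i) a) (cube (y j) a))) :
    iIndepFun (fun i ω => (P ω).inCube (y i) a) μ := by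
  classical
  -- it suffices to consider finitely many counts in each cube, and these are sums of counts of
  -- disjoint sets
  have key : iIndepFun (fun i ω => allCounts ((P ω).inCube (y i) a)) μ := by
    refine iIndepFun.iIndepFun_process (T := fun _ => {A : Set (Pt d) // MeasurableSet A})
      (X := fun i A ω => ptCount A.1 ((P ω).inCube (y i) a))
      (fun i A => (measurable_ptCount A.2).comp (measurable_inCube_comp hP _ _)) fun I J => ?_
    let A : (i : I) → J i → Set (Pt d) := fun i j => j.1.1
    have hA (i : I) (j : J i) : MeasurableSet (A i j) := j.1.2
    have hB (i : I) (T : Finset (J i)) : MeasurableSet (atom (A i) T ∩ cube (y i) a) :=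
      (measurableSet_atom (hA i) T).inter (measurableSet_cube _ _)
    have h1 : iIndepFun (fun (p : (i : I) × Finset (J i)) ω =>
        (P ω).count (atom (A p.1) p.2 ∩ cube (y p.1) a)) μ := by
      refine iIndepFun_count hP (fun p => hB p.1 p.2) ?_
      rintro ⟨i, S⟩ ⟨j, T⟩ hne
      by_cases hij : i = j
      · subst hij
        have hST : S ≠ T := fun h => hne (by rw [h])
        exact (disjoint_atom hST).mono Set.inter_subset_left Set.inter_subset_left
      · exact (hd (fun h => hij (Subtype.ext h))).mono Set.inter_subset_right
          Set.inter_subset_right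
    have h2 := iIndepFun_curry (X := fun (i : I) (T : Finset (J i)) ω =>
      (P ω).count (atom (A i) T ∩ cube (y i) a))
      (fun i T => (measurable_count (hB i T)).comp hP.measurable) h1
    have h3 := h2.comp (fun i c (j : J i) => ∑ T : Finset (J i), if j ∈ T then
      ((c T).toNat : ℝ) else 0) (fun i => by
        refine measurable_pi_lambda _ fun j => Finset.measurable_fun_sum _ fun T _ => ?_
        split_ifs
        · exact (measurable_from_top (f := fun n : ℕ∞ => (n.toNat : ℝ))).comp
            (measurable_pi_apply T)
        · exact measurable_const)
    convert h3 using 1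
    funext i ω j
    simp only [Function.comp, ← ptCount_inCube]
    exact ptCount_eq_sum_atom (A := A i) j _
  rw [iIndepFun_iff_iIndep] at key ⊢
  convert key using 2 with i
  rw [← comap_allCounts, MeasurableSpace.comap_comp]
  rfl

end Poisson

/-- The configuration shifted by `-x`. -/
def translate (φ : Configuration d) (x : Pt d) : Configuration d where
  carrier := {z | z + x ∈ φ.carrier}
  finite_inter B hB := by
    have h := (φ.finite_inter ((fun z => z + x) '' B)
      ((IsometryEquiv.addRight x).isometry.lipschitz.isBounded_image hB))
    refine (h.preimage (f := fun z => z + x) (add_left_injective x).injOn).subset ?_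
    rintro z ⟨hz, hzB⟩
    exact ⟨hz, z, hzB, rfl⟩

lemma count_translate (φ : Configuration d) (x : Pt d) (A : Set (Pt d)) :
    (translate φ x).count A = φ.count ((fun z => z - x) ⁻¹' A) := by
  unfold Configuration.count
  rw [← (add_left_injective x).encard_image]
  congr 1
  ext z
  constructor
  · rintro ⟨w, ⟨hw, hwA⟩, rfl⟩
    exact ⟨hw, by simpa using hwA⟩
  · rintro ⟨hz, hzA⟩
    exact ⟨z - x, ⟨by simpa [translate] using hz, hzA⟩, by simp⟩

lemma isHomogeneousPoisson_translate {Ω : Type*} [MeasurableSpace Ω] {μ : Measure Ω} {lam : ℝ≥0}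
    {P : Ω → Configuration d} (hP : IsHomogeneousPoisson lam P μ) (x : Pt d) :
    IsHomogeneousPoisson lam (fun ω => translate (P ω) x) μ := by
  have hpre {A : Set (Pt d)} (hA : MeasurableSet A) : MeasurableSet ((fun z => z - x) ⁻¹' A) :=
    (measurable_sub_const x) hA
  refine ⟨?_, ?_, ?_⟩
  · refine measurable_iff_comap_le.2 ?_
    simp only [Configuration.instMeasurableSpace, MeasurableSpace.comap_iSup,
      MeasurableSpace.comap_comp]
    refine iSup₂_le fun A hA => ?_
    rw [← measurable_iff_comap_le]
    simp only [Function.comp_def, count_translate]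
    exact (measurable_count (hpre hA)).comp hP.measurable
  · intro A hA hAb
    simp only [count_translate]
    have hb : Bornology.IsBounded ((fun z => z - x) ⁻¹' A) := by
      have : (fun z => z - x) ⁻¹' A = (fun z => z + x) '' A := by
        ext z
        constructor
        · intro hz; exact ⟨z - x, hz, by simp⟩
        · rintro ⟨w, hw, rfl⟩; simpa using hw
      rw [this]
      exact (IsometryEquiv.addRight x).isometry.lipschitz.isBounded_image hAb
    have hv : volume ((fun z => z - x) ⁻¹' A) = volume A :=
      (measurePreserving_sub_right volume x).measure_preimage hA.nullMeasurableSet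
    rw [← hv]
    exact hP.hasLaw_count _ (hpre hA) hb
  · intro k A hA hd
    simp only [count_translate]
    exact hP.iIndepFun_count k _ (fun i => hpre (hA i))
      (fun i j hij => (hd hij).preimage _)

lemma mem_inCube (φ : Configuration d) (y : Pt d) (a : ℝ) (z : Pt d) :
    z ∈ φ.inCube y a ↔ z ∈ φ.carrier ∧ z ∈ cube y a := by
  simp [Configuration.inCube, Configuration.restrict]

lemma mem_cube_sub (y x : Pt d) (a : ℝ) (z : Pt d) : z ∈ cube (y - x) a ↔ z + x ∈ cube y a := by
  refine forall_congr' fun i => ?_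
  simp only [PiLp.sub_apply, PiLp.add_apply]
  constructor <;> rintro ⟨h1, h2⟩ <;> constructor <;> linarith

lemma inCube_translate (φ : Configuration d) (x y : Pt d) (a : ℝ) :
    (translate φ x).inCube (y - x) a = (φ.inCube y a).map (addLeftEmbedding (-x)) := by
  ext z
  rw [mem_inCube, mem_cube_sub, Finset.mem_map]
  constructor
  · rintro ⟨h1, h2⟩
    exact ⟨z + x, (mem_inCube _ _ _ _).2 ⟨h1, h2⟩, by simp⟩
  · rintro ⟨w, hw, rfl⟩
    rw [mem_inCube] at hw
    simpa [translate] using hw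

/-- Shifting the points in a cube gives in law the points in the shifted cube. -/
lemma lintegral_inCube_sub [NeZero d] {Ω : Type*} [MeasurableSpace Ω] {μ : Measure Ω}
    [IsProbabilityMeasure μ] {lam : ℝ≥0} {P : Ω → Configuration d}
    (hP : IsHomogeneousPoisson lam P μ) {Φ : Finset (Pt d) → ℝ≥0∞} (hΦ : Measurable Φ)
    (x y : Pt d) (a : ℝ) :
    ∫⁻ ω, Φ (((P ω).inCube y a).map (addLeftEmbedding (-x))) ∂μ =
      ∫⁻ ω, Φ ((P ω).inCube (y - x) a) ∂μ := by
  have hP' := isHomogeneousPoisson_translate hP x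
  simp only [← inCube_translate]
  rw [← lintegral_map hΦ (measurable_inCube_comp hP' _ _),
    ← lintegral_map hΦ (measurable_inCube_comp hP _ _), map_inCube hP', map_inCube hP]

open Classical in
lemma inCube_filter (φ : Configuration d) {y y' : Pt d} {a a' : ℝ}
    (h : cube y' a' ⊆ cube y a) :
    (φ.inCube y a).filter (· ∈ cube y' a') = φ.inCube y' a' := by
  ext z
  simp only [Finset.mem_filter, mem_inCube]
  exact ⟨fun h => ⟨h.1.1, h.2⟩, fun h' => ⟨⟨h'.1, h h'.2⟩, h'.2⟩⟩

lemma addOneCost_eq_map {H : Finset (Pt d) → ℝ} (hinv : TranslationInvariant H) (x : Pt d)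
    (s : Finset (Pt d)) :
    addOneCost H x s = addOneCost H 0 (s.map (addLeftEmbedding (-x))) := by
  classical
  unfold addOneCost
  rw [hinv s (-x)]
  congr 1
  rw [← hinv _ (-x)]
  congr 1
  rw [Finset.map_insert]
  simp

end Restriction

/-! ### The central limit theorem by approximation in variance -/

section Approx

section Approximation

variable {Ω : Type*} [MeasurableSpace Ω] {μ : Measure Ω} [IsProbabilityMeasure μ]
  {X Y : Ω → ℝ}

lemma sqrt_variance_add_le (hX : MemLp X 2 μ) (hY : MemLp Y 2 μ) :
    √Var[X + Y; μ] ≤ √Var[X; μ] + √Var[Y; μ] := by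
  -- the Cauchy–Schwarz inequality for the covariance, by the discriminant of `Var (X + c Y)`
  have hquad (c : ℝ) : 0 ≤ Var[Y; μ] * (c * c) + (2 * cov[X, Y; μ]) * c + Var[X; μ] := by
    have h := variance_nonneg (X + c • Y) μ
    rw [variance_add hX (hY.const_smul c), covariance_smul_right, variance_smul] at h
    linarith
  have hd := discrim_le_zero hquad
  have hcov : cov[X, Y; μ] ≤ √Var[X; μ] * √Var[Y; μ] := by
    rw [← Real.sqrt_mul (variance_nonneg _ _)]
    refine Real.le_sqrt_of_sq_le ?_
    unfold discrim at hd
    nlinarith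
  rw [Real.sqrt_le_left (by positivity), variance_add hX hY]
  nlinarith [Real.sq_sqrt (variance_nonneg X μ), Real.sq_sqrt (variance_nonneg Y μ)]

lemma abs_sqrt_variance_sub_le (hX : MemLp X 2 μ) (hY : MemLp Y 2 μ) :
    |√Var[X; μ] - √Var[Y; μ]| ≤ √Var[X - Y; μ] := by
  have h1 := sqrt_variance_add_le (hX.sub hY) hY
  have h2 := sqrt_variance_add_le (hY.sub hX) hX
  rw [sub_add_cancel] at h1 h2
  have e : Var[Y - X; μ] = Var[X - Y; μ] := by
    rw [← neg_sub, variance_neg]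
  rw [e] at h2
  rw [abs_le]
  constructor <;> linarith

lemma integral_abs_le_sqrt (hX : MemLp X 2 μ) : ∫ ω, |X ω| ∂μ ≤ √(∫ ω, X ω ^ 2 ∂μ) := by
  refine Real.le_sqrt_of_sq_le ?_
  have h := variance_nonneg |X| μ
  rw [variance_eq_sub hX.abs] at h
  simp only [Pi.pow_apply, Pi.abs_apply, sq_abs] at h
  linarith

lemma norm_exp_mul_I_sub_le (x y : ℝ) :
    ‖Complex.exp (x * Complex.I) - Complex.exp (y * Complex.I)‖ ≤ |x - y| := by
  have e : Complex.exp (x * Complex.I) - Complex.exp (y * Complex.I) =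
      Complex.exp (y * Complex.I) * (Complex.exp (Complex.I * ((x - y : ℝ) : ℂ)) - 1) := by
    rw [mul_sub, ← Complex.exp_add, mul_one]
    congr 2
    push_cast
    ring
  rw [e, norm_mul, Complex.norm_exp_ofReal_mul_I, one_mul]
  exact Real.norm_exp_I_mul_ofReal_sub_one_le

/-- Characteristic functions depend on the variable in a Lipschitz way with respect to `L²`. -/
lemma norm_charFun_sub_le (hX : MemLp X 2 μ) (hY : MemLp Y 2 μ) (s t : ℝ) :
    ‖charFun (μ.map X) s - charFun (μ.map Y) t‖ ≤ √(∫ ω, (s * X ω - t * Y ω) ^ 2 ∂μ) := by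
  have hL : MemLp (fun ω => s * X ω - t * Y ω) 2 μ := (hX.const_mul s).sub (hY.const_mul t)
  have hi (Z : Ω → ℝ) (hZ : MemLp Z 2 μ) (r : ℝ) :
      Integrable (fun ω => Complex.exp ((r * Z ω : ℝ) * Complex.I)) μ := by
    refine Integrable.of_bound ?_ 1 (ae_of_all _ fun ω => (Complex.norm_exp_ofReal_mul_I _).le)
    have := hZ.aestronglyMeasurable.aemeasurable
    exact AEMeasurable.aestronglyMeasurable (by fun_prop)
  have e (Z : Ω → ℝ) (hZ : MemLp Z 2 μ) (r : ℝ) : charFun (μ.map Z) r =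
      ∫ ω, Complex.exp ((r * Z ω : ℝ) * Complex.I) ∂μ := by
    rw [charFun_apply_real, integral_map hZ.aestronglyMeasurable.aemeasurable (by fun_prop)]
    push_cast
    rfl
  rw [e X hX, e Y hY, ← integral_sub (hi X hX s) (hi Y hY t)]
  refine (norm_integral_le_integral_norm _).trans ((integral_mono ?_ ?_ fun ω => ?_).trans
    (integral_abs_le_sqrt hL))
  · exact ((hi X hX s).sub (hi Y hY t)).norm
  · exact hL.abs.integrable one_le_two
  · exact norm_exp_mul_I_sub_le _ _

/-- The centred variable `X - E X`. -/
noncomputable def centre (μ : Measure Ω) (X : Ω → ℝ) : Ω → ℝ := fun ω => X ω - ∫ ω', X ω' ∂μ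

lemma memLp_centre (hX : MemLp X 2 μ) : MemLp (centre μ X) 2 μ := hX.sub (memLp_const _)

lemma integral_centre_sub_sq (hX : MemLp X 2 μ) (hY : MemLp Y 2 μ) :
    ∫ ω, (centre μ X ω - centre μ Y ω) ^ 2 ∂μ = Var[X - Y; μ] := by
  rw [variance_eq_integral (hX.sub hY).aestronglyMeasurable.aemeasurable]
  congr 1 with ω
  simp only [centre, Pi.sub_apply]
  rw [integral_sub (hX.integrable one_le_two) (hY.integrable one_le_two)]
  ring

omit [IsProbabilityMeasure μ] in
lemma integral_centre_sq (hX : MemLp X 2 μ) : ∫ ω, centre μ X ω ^ 2 ∂μ = Var[X; μ] := by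
  rw [variance_eq_integral hX.aestronglyMeasurable.aemeasurable]
  rfl

/-- The central limit theorem for powers of characteristic functions, with any variance. -/
lemma tendsto_charFun_centre_pow (hX : MemLp X 2 μ) (u : ℝ) :
    Tendsto (fun k : ℕ => charFun (μ.map (centre μ X)) ((√k)⁻¹ * u) ^ k) atTop
      (𝓝 (Complex.exp (-(Var[X; μ] * u ^ 2 / 2 : ℝ)))) := by
  have hXm := hX.aestronglyMeasurable.aemeasurable
  have hi := hX.integrable one_le_two
  by_cases hv : Var[X; μ] = 0
  · have h0 : centre μ X =ᵐ[μ] fun _ => 0 := by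
      filter_upwards [ae_eq_integral_of_variance_eq_zero hX hv] with ω hω
      simp [centre, hω]
    have : μ.map (centre μ X) = Measure.dirac 0 := by
      rw [Measure.map_congr h0, Measure.map_const]
      simp
    simp [this, hv]
  · have hvpos : 0 < Var[X; μ] := lt_of_le_of_ne (variance_nonneg _ _) (Ne.symm hv)
    set σ := √Var[X; μ] with hσ
    have hσpos : 0 < σ := Real.sqrt_pos.2 hvpos
    have hσsq : σ ^ 2 = Var[X; μ] := Real.sq_sqrt hvpos.le
    let Z : Ω → ℝ := fun ω => σ⁻¹ * centre μ X ω
    have hcm : AEMeasurable (centre μ X) μ := (memLp_centre hX).aestronglyMeasurable.aemeasurable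
    have hZm : AEMeasurable Z μ := hcm.const_mul _
    have hZ0 : μ[Z] = 0 := by
      simp only [Z, integral_const_mul, centre]
      rw [integral_sub hi (integrable_const _)]
      simp
    have hZ1 : μ[Z ^ 2] = 1 := by
      simp only [Z, Pi.pow_apply, mul_pow, integral_const_mul, integral_centre_sq hX]
      rw [← hσsq]
      field_simp
    have h := tendsto_charFun_inv_sqrt_mul_pow hZm hZ0 hZ1 (σ * u)
    have e : (fun k : ℕ => charFun (μ.map (centre μ X)) ((√k)⁻¹ * u) ^ k) =
        fun k : ℕ => charFun (μ.map Z) ((√k)⁻¹ * (σ * u)) ^ k := by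
      funext k
      rw [charFun_map_mul_comp hcm]
      congr 2
      field_simp
    rw [e]
    convert h using 2
    rw [← hσsq]
    push_cast
    ring_nf

/-- If, up to a variance of order `ε n`, the variables `F n` are sums of about `ρ n` independent
copies of one square integrable variable, for every `ε > 0`, then their variances divided by `n`
converge and they satisfy the central limit theorem. The sums enter only through their variance
and characteristic function. -/
theorem exists_tendsto_of_approx {F : ℝ → Ω → ℝ} (hF : ∀ n, 0 < n → MemLp (F n) 2 μ)
    (happ : ∀ ε : ℝ, 0 < ε → ∃ (ρ : ℝ) (X : Ω → ℝ) (m : ℝ → ℕ) (S : ℝ → Ω → ℝ),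
      0 < ρ ∧ MemLp X 2 μ ∧ Tendsto (fun n : ℝ => (m n : ℝ) / n) atTop (𝓝 ρ) ∧
      (∀ᶠ n in atTop, MemLp (S n) 2 μ ∧ Var[S n; μ] = m n * Var[X; μ] ∧
        (∀ t, charFun (μ.map (centre μ (S n))) t = charFun (μ.map (centre μ X)) t ^ m n) ∧
        Var[F n - S n; μ] ≤ ε * n)) :
    ∃ v : ℝ≥0, Tendsto (fun n : ℝ => Var[F n; μ] / n) atTop (𝓝 (v : ℝ)) ∧
      ∀ t : ℝ, Tendsto (fun n : ℝ => charFun (μ.map (centre μ (F n))) ((√n)⁻¹ * t)) atTop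
        (𝓝 (Complex.exp (-(v * t ^ 2 / 2 : ℝ)))) := by
  set sd : ℝ → ℝ := fun n => √(Var[F n; μ] / n) with hsd
  -- the standard deviation and the characteristic function are both within a multiple of `δ`
  -- of those of a Gaussian with standard deviation `c`
  have key (δ : ℝ) (hδ : 0 < δ) : ∃ c : ℝ, 0 ≤ c ∧ (∀ᶠ n in atTop, |sd n - c| ≤ 2 * δ) ∧
      ∀ t : ℝ, ∀ᶠ n in atTop, ‖charFun (μ.map (centre μ (F n))) ((√n)⁻¹ * t) -
        Complex.exp (-(c ^ 2 * t ^ 2 / 2 : ℝ))‖ ≤ |t| * δ + 2 * δ := by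
    obtain ⟨ρ, X, m, S, hρ, hX, hm, hS⟩ := happ (δ ^ 2) (by positivity)
    have hv := variance_nonneg X μ
    have hsqrt : Tendsto (fun n : ℝ => √((m n : ℝ) / n)) atTop (𝓝 √ρ) := hm.sqrt
    refine ⟨√ρ * √Var[X; μ], by positivity, ?_, fun t => ?_⟩
    · have h1 : Tendsto (fun n : ℝ => √((m n : ℝ) / n) * √Var[X; μ]) atTop
          (𝓝 (√ρ * √Var[X; μ])) := hsqrt.mul_const _
      have h2 := (Metric.tendsto_nhds.1 h1) δ hδ
      filter_upwards [h2, hS, eventually_gt_atTop 0] with n hn ⟨hSL, hSV, _, hd⟩ hn0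
      have h3 := abs_sqrt_variance_sub_le (hF n hn0) hSL
      have hsn : 0 < √n := Real.sqrt_pos.2 hn0
      have h4 : √Var[F n - S n; μ] ≤ δ * √n := by
        rw [Real.sqrt_le_left (by positivity), mul_pow, Real.sq_sqrt hn0.le]
        exact hd
      have h5 : |sd n - √((m n : ℝ) / n) * √Var[X; μ]| ≤ δ := by
        have e : sd n - √((m n : ℝ) / n) * √Var[X; μ] =
            (√Var[F n; μ] - √Var[S n; μ]) / √n := by
          rw [hSV, Real.sqrt_mul (Nat.cast_nonneg _), Real.sqrt_div (Nat.cast_nonneg _), hsd]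
          simp only
          rw [Real.sqrt_div (variance_nonneg _ _)]
          ring
        rw [e, abs_div, abs_of_pos hsn, div_le_iff₀ hsn]
        exact h3.trans h4
      rw [Real.dist_eq] at hn
      calc |sd n - √ρ * √Var[X; μ]| ≤ |sd n - √((m n : ℝ) / n) * √Var[X; μ]| +
            |√((m n : ℝ) / n) * √Var[X; μ] - √ρ * √Var[X; μ]| := abs_sub_le _ _ _
        _ ≤ 2 * δ := by linarith
    · have hminf : Tendsto m atTop atTop := by
        have h1 : Tendsto (fun n : ℝ => (m n : ℝ)) atTop atTop := by
          have := hm.pos_mul_atTop hρ tendsto_id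
          refine this.congr' ?_
          filter_upwards [eventually_gt_atTop 0] with n hn
          simp only [id]
          field_simp
        exact tendsto_natCast_atTop_iff.1 h1
      have h1 := (tendsto_charFun_centre_pow hX (√ρ * t)).comp hminf
      have h1' := (Metric.tendsto_nhds.1 h1) δ hδ
      have h2 : Tendsto (fun n : ℝ => |t| * √Var[X; μ] * |√((m n : ℝ) / n) - √ρ|) atTop (𝓝 0) := by
        have : Tendsto (fun n : ℝ => |t| * √Var[X; μ] * |√((m n : ℝ) / n) - √ρ|) atTop
            (𝓝 (|t| * √Var[X; μ] * |√ρ - √ρ|)) := ((hsqrt.sub_const _).abs).const_mul _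
        simpa using this
      have h2' := h2.eventually (Iio_mem_nhds hδ)
      have hmpos : ∀ᶠ n in atTop, 0 < m n := hminf.eventually (eventually_gt_atTop 0)
      filter_upwards [h1', h2', hS, eventually_gt_atTop 0, hmpos] with n hn1 hn2
        ⟨hSL, hSV, hSc, hd⟩ hn0 hm0
      have hsn : 0 < √n := Real.sqrt_pos.2 hn0
      have hm0' : (0 : ℝ) < m n := by exact_mod_cast hm0
      have hsm : 0 < √(m n : ℝ) := Real.sqrt_pos.2 hm0'
      have hFL := hF n hn0
      -- replace `F n` by `S n`
      have a1 : ‖charFun (μ.map (centre μ (F n))) ((√n)⁻¹ * t) -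
          charFun (μ.map (centre μ (S n))) ((√n)⁻¹ * t)‖ ≤ |t| * δ := by
        refine (norm_charFun_sub_le (memLp_centre hFL) (memLp_centre hSL) _ _).trans ?_
        have e : ∫ ω, ((√n)⁻¹ * t * centre μ (F n) ω - (√n)⁻¹ * t * centre μ (S n) ω) ^ 2 ∂μ =
            ((√n)⁻¹ * t) ^ 2 * Var[F n - S n; μ] := by
          rw [← integral_centre_sub_sq hFL hSL, ← integral_const_mul]
          congr 1 with ω
          ring
        rw [e, Real.sqrt_le_left (by positivity), mul_pow, mul_pow, sq_abs, inv_pow,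
          Real.sq_sqrt hn0.le]
        calc n⁻¹ * t ^ 2 * Var[F n - S n; μ] ≤ n⁻¹ * t ^ 2 * (δ ^ 2 * n) := by gcongr
          _ = t ^ 2 * δ ^ 2 := by field_simp
      -- replace the normalization by `n` with the one by the number of summands
      have a2 : ‖charFun (μ.map (centre μ (S n))) ((√n)⁻¹ * t) -
          charFun (μ.map (centre μ (S n))) ((√(m n : ℝ))⁻¹ * (√ρ * t))‖ ≤ δ := by
        refine (norm_charFun_sub_le (memLp_centre hSL) (memLp_centre hSL) _ _).trans ?_
        have e : ∫ ω, ((√n)⁻¹ * t * centre μ (S n) ω -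
            (√(m n : ℝ))⁻¹ * (√ρ * t) * centre μ (S n) ω) ^ 2 ∂μ =
            (|t| * √Var[X; μ] * |√((m n : ℝ) / n) - √ρ|) ^ 2 := by
          have : ∫ ω, ((√n)⁻¹ * t * centre μ (S n) ω -
              (√(m n : ℝ))⁻¹ * (√ρ * t) * centre μ (S n) ω) ^ 2 ∂μ =
              ((√n)⁻¹ * t - (√(m n : ℝ))⁻¹ * (√ρ * t)) ^ 2 * ∫ ω, centre μ (S n) ω ^ 2 ∂μ := by
            rw [← integral_const_mul]
            congr 1 with ω
            ring
          rw [this, integral_centre_sq hSL, hSV, mul_pow, mul_pow, sq_abs, sq_abs, Real.sq_sqrt hv,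
            Real.sqrt_div hm0'.le]
          have hmm : (m n : ℝ) = √(m n : ℝ) ^ 2 := (Real.sq_sqrt hm0'.le).symm
          have : ((√n)⁻¹ * t - (√(m n : ℝ))⁻¹ * (√ρ * t)) ^ 2 * ((m n : ℝ) * Var[X; μ]) =
              ((√n)⁻¹ * t - (√(m n : ℝ))⁻¹ * (√ρ * t)) ^ 2 * (√(m n : ℝ) ^ 2 * Var[X; μ]) := by
            rw [← hmm]
          rw [this]
          field_simp
        rw [e, Real.sqrt_sq (by positivity)]
        exact le_of_lt hn2
      -- the classical central limit theorem
      have a3 : ‖charFun (μ.map (centre μ (S n))) ((√(m n : ℝ))⁻¹ * (√ρ * t)) -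
          Complex.exp (-((√ρ * √Var[X; μ]) ^ 2 * t ^ 2 / 2 : ℝ))‖ ≤ δ := by
        rw [hSc]
        have e : (√ρ * √Var[X; μ]) ^ 2 * t ^ 2 / 2 = Var[X; μ] * (√ρ * t) ^ 2 / 2 := by
          rw [mul_pow, mul_pow, Real.sq_sqrt hv]; ring
        rw [e]
        simp only [Function.comp] at hn1
        rw [dist_eq_norm] at hn1
        exact hn1.le
      calc _ ≤ _ + _ := norm_sub_le_norm_sub_add_norm_sub _
              (charFun (μ.map (centre μ (S n))) ((√n)⁻¹ * t)) _
        _ ≤ |t| * δ + (δ + δ) := add_le_add a1 ((norm_sub_le_norm_sub_add_norm_sub _ _ _).trans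
            (add_le_add a2 a3))
        _ = |t| * δ + 2 * δ := by ring
  have hcauchy : CauchySeq sd := by
    rw [Metric.cauchySeq_iff']
    intro ε hε
    obtain ⟨c, -, hc, -⟩ := key (ε / 5) (by positivity)
    obtain ⟨N, hN⟩ := eventually_atTop.1 hc
    refine ⟨N, fun n hn => ?_⟩
    rw [Real.dist_eq]
    have h1 := hN n hn
    have h2 := hN N le_rfl
    rw [abs_sub_comm] at h2
    calc |sd n - sd N| ≤ |sd n - c| + |c - sd N| := abs_sub_le _ _ _
      _ < ε := by linarith
  obtain ⟨s, hs⟩ := cauchySeq_tendsto_of_complete hcauchy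
  have hs0 : 0 ≤ s := ge_of_tendsto' hs fun n => Real.sqrt_nonneg _
  refine ⟨⟨s ^ 2, sq_nonneg s⟩, ?_, fun t => ?_⟩
  · refine (hs.pow 2).congr' ?_
    filter_upwards [eventually_gt_atTop 0] with n hn
    exact Real.sq_sqrt (div_nonneg (variance_nonneg _ _) hn.le)
  · rw [Metric.tendsto_nhds]
    intro η hη
    have hcont : Continuous fun c : ℝ => Complex.exp (-(c ^ 2 * t ^ 2 / 2 : ℝ)) := by fun_prop
    obtain ⟨κ, hκ, hκ'⟩ := Metric.continuous_iff.1 hcont s (η / 2) (by positivity)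
    obtain ⟨δ, hδ, hδ1, hδ2⟩ : ∃ δ : ℝ, 0 < δ ∧ 3 * δ < κ ∧ |t| * δ + 2 * δ < η / 2 := by
      refine ⟨min (κ / 4) (η / (4 * (|t| + 2))), by positivity, ?_, ?_⟩
      · have := min_le_left (κ / 4) (η / (4 * (|t| + 2)))
        linarith
      · have h1 := min_le_right (κ / 4) (η / (4 * (|t| + 2)))
        have ht : 0 < |t| + 2 := by positivity
        have h2 : (|t| + 2) * min (κ / 4) (η / (4 * (|t| + 2))) ≤
            (|t| + 2) * (η / (4 * (|t| + 2))) := mul_le_mul_of_nonneg_left h1 ht.le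
        have h3 : (|t| + 2) * (η / (4 * (|t| + 2))) = η / 4 := by field_simp
        nlinarith
    obtain ⟨c, hc0, hc1, hc2⟩ := key δ hδ
    have hcs : |c - s| ≤ 2 * δ := by
      have : Tendsto (fun n => |sd n - c|) atTop (𝓝 |s - c|) := (hs.sub_const c).abs
      rw [abs_sub_comm]
      exact le_of_tendsto this hc1
    have h1 := hκ' c (by rw [Real.dist_eq]; linarith)
    filter_upwards [hc2 t] with n hn
    calc dist (charFun (μ.map (centre μ (F n))) ((√n)⁻¹ * t))
          (Complex.exp (-(s ^ 2 * t ^ 2 / 2 : ℝ)))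
        ≤ dist (charFun (μ.map (centre μ (F n))) ((√n)⁻¹ * t))
            (Complex.exp (-(c ^ 2 * t ^ 2 / 2 : ℝ))) +
          dist (Complex.exp (-(c ^ 2 * t ^ 2 / 2 : ℝ))) (Complex.exp (-(s ^ 2 * t ^ 2 / 2 : ℝ))) :=
          dist_triangle _ _ _
      _ < η := by
          rw [dist_eq_norm]
          linarith

/-- Convergence in distribution along the reals from pointwise convergence of characteristic
functions, for a centred Gaussian limit. -/
lemma tendstoInDistribution_gaussian {Z : ℝ → Ω → ℝ} (hZ : ∀ n, AEMeasurable (Z n) μ) {v : ℝ≥0}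
    (h : ∀ t : ℝ, Tendsto (fun n : ℝ => charFun (μ.map (Z n)) t) atTop
      (𝓝 (Complex.exp (-(v * t ^ 2 / 2 : ℝ))))) :
    TendstoInDistribution Z atTop id (fun _ => μ) (gaussianReal 0 v) where
  forall_aemeasurable := hZ
  aemeasurable_limit := aemeasurable_id
  tendsto := by
    refine tendsto_of_seq_tendsto fun u hu => ?_
    refine ProbabilityMeasure.tendsto_iff_tendsto_charFun.2 fun t => ?_
    have h1 := (h t).comp hu
    have e : charFun (gaussianReal 0 v) t = Complex.exp (-(v * t ^ 2 / 2 : ℝ)) := by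
      rw [charFun_gaussianReal]
      congr 1
      push_cast
      ring
    simp only [Measure.map_id, ProbabilityMeasure.coe_mk, e]
    exact h1

end Approximation

end Approx

/-! ### Stabilization in `L²` -/

section Stabilization

/-- A bound on moments of order `p > 2` makes almost sure convergence to zero hold in `L²`. -/
lemma tendsto_lintegral_sq_of_ae {Ω : Type*} [MeasurableSpace Ω] {μ : Measure Ω}
    [IsProbabilityMeasure μ] {Z : ℕ → Ω → ℝ} (hZ : ∀ k, Measurable (Z k)) {p : ℝ} (hp : 2 < p)
    {C : ℝ≥0∞} (hC : C < ∞) (hb : ∀ k, ∫⁻ ω, ‖Z k ω‖ₑ ^ p ∂μ ≤ C)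
    (hlim : ∀ᵐ ω ∂μ, Tendsto (fun k => Z k ω) atTop (𝓝 0)) :
    Tendsto (fun k => ∫⁻ ω, ‖Z k ω‖ₑ ^ 2 ∂μ) atTop (𝓝 0) := by
  -- above a large level `M`, the square is at most `δ` times the `p`-th power
  have key (δ : ℝ) (hδ : 0 < δ) : ∃ K : ℝ, ∀ z : ℝ,
      ‖z‖ₑ ^ 2 ≤ min (‖z‖ₑ ^ 2) (ENNReal.ofReal K) + ENNReal.ofReal δ * ‖z‖ₑ ^ p := by
    obtain ⟨M, hM0, hM⟩ := ((tendsto_rpow_atTop (sub_pos.2 hp)).eventually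
      (eventually_ge_atTop (1 / δ))).exists_forall_of_atTop |>.imp fun M hM =>
        (show 0 ≤ |M| ∧ ∀ b ≥ |M| + 1, 1 / δ ≤ b ^ (p - 2) from
          ⟨abs_nonneg M, fun b hb => hM b (by linarith [le_abs_self M])⟩)
    refine ⟨(|M| + 1) ^ 2, fun z => ?_⟩
    rcases le_or_gt |z| (|M| + 1) with hz | hz
    · rw [enorm_sq_eq_ofReal, min_eq_left]
      · exact le_self_add
      · refine ENNReal.ofReal_le_ofReal ?_
        rw [← sq_abs]
        exact pow_le_pow_left₀ (abs_nonneg z) hz 2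
    · refine le_trans ?_ le_add_self
      have hz0 : 0 < |z| := by linarith
      rw [Real.enorm_eq_ofReal_abs, ENNReal.ofReal_rpow_of_nonneg hz0.le (by linarith),
        ← ENNReal.ofReal_mul hδ.le, ← ENNReal.ofReal_pow hz0.le]
      refine ENNReal.ofReal_le_ofReal ?_
      have h1 := hM |z| hz.le
      rw [div_le_iff₀ hδ] at h1
      have h2 : |z| ^ p = |z| ^ (p - 2) * |z| ^ 2 := by
        rw [← Real.rpow_natCast, ← Real.rpow_add hz0]
        norm_num
      rw [h2]
      nlinarith [sq_nonneg |z|]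
  rw [ENNReal.tendsto_nhds_zero]
  intro ε hε
  rcases eq_or_ne ε ∞ with rfl | hεtop
  · simp
  obtain ⟨δ, hδ, hδC⟩ : ∃ δ : ℝ, 0 < δ ∧ ENNReal.ofReal δ * C ≤ ε / 2 := by
    have hε2 : 0 < ε / 2 := ENNReal.half_pos hε.ne'
    have hC1 : C + 1 ≠ ∞ := by simp [hC.ne]
    refine ⟨(ε / 2 / (C + 1)).toReal, ?_, ?_⟩
    · exact ENNReal.toReal_pos (ENNReal.div_pos hε2.ne' hC1).ne'
        (ENNReal.div_lt_top (ENNReal.div_lt_top hεtop (by simp)).ne (by simp)).ne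
    · rw [ENNReal.ofReal_toReal
        (ENNReal.div_lt_top (ENNReal.div_lt_top hεtop (by simp)).ne (by simp)).ne]
      calc ε / 2 / (C + 1) * C ≤ ε / 2 / (C + 1) * (C + 1) := by gcongr; exact le_self_add
        _ = ε / 2 := ENNReal.div_mul_cancel (by simp) hC1
  obtain ⟨K, hK⟩ := key δ hδ
  have h1 : Tendsto (fun k => ∫⁻ ω, min (‖Z k ω‖ₑ ^ 2) (ENNReal.ofReal K) ∂μ) atTop
      (𝓝 (∫⁻ _, 0 ∂μ)) := by
    refine tendsto_lintegral_of_dominated_convergence (fun _ => ENNReal.ofReal K)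
      (fun k => ((hZ k).enorm.pow_const 2).min measurable_const)
      (fun k => ae_of_all _ fun ω => min_le_right _ _) (by simp) ?_
    filter_upwards [hlim] with ω hω
    have h2 : Tendsto (fun k => ‖Z k ω‖ₑ ^ 2) atTop (𝓝 0) := by
      have := ENNReal.Tendsto.pow (n := 2) hω.enorm
      simpa using this
    have h3 := h2.min (tendsto_const_nhds (x := ENNReal.ofReal K))
    simpa using h3
  rw [lintegral_zero, ENNReal.tendsto_nhds_zero] at h1
  filter_upwards [h1 (ε / 2) (ENNReal.half_pos hε.ne')] with k hk
  calc ∫⁻ ω, ‖Z k ω‖ₑ ^ 2 ∂μ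
      ≤ ∫⁻ ω, (min (‖Z k ω‖ₑ ^ 2) (ENNReal.ofReal K) + ENNReal.ofReal δ * ‖Z k ω‖ₑ ^ p) ∂μ :=
        lintegral_mono fun ω => hK _
    _ = ∫⁻ ω, min (‖Z k ω‖ₑ ^ 2) (ENNReal.ofReal K) ∂μ +
        ENNReal.ofReal δ * ∫⁻ ω, ‖Z k ω‖ₑ ^ p ∂μ := by
        rw [lintegral_add_left (((hZ k).enorm.pow_const 2).min measurable_const),
          lintegral_const_mul _ ((hZ k).enorm.pow_const p)]
    _ ≤ ε / 2 + ε / 2 := by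
        gcongr
        exact (mul_le_mul_right (hb k) _).trans hδC
    _ = ε := ENNReal.add_halves ε

lemma enorm_sub_sq_le (a b : ℝ) : ‖a - b‖ₑ ^ 2 ≤ 2 * ‖a‖ₑ ^ 2 + 2 * ‖b‖ₑ ^ 2 := by
  simp only [enorm_sq_eq_ofReal]
  have : (2 : ℝ≥0∞) = ENNReal.ofReal 2 := by simp
  rw [this, ← ENNReal.ofReal_mul zero_le_two, ← ENNReal.ofReal_mul zero_le_two,
    ← ENNReal.ofReal_add (by positivity) (by positivity)]
  exact ENNReal.ofReal_le_ofReal (by nlinarith [sq_nonneg (a + b)])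

variable {d : ℕ} {Ω : Type*} [MeasurableSpace Ω] {μ : Measure Ω} [IsProbabilityMeasure μ]
  {lam : ℝ≥0} {P : Ω → Configuration d} {H : Finset (Pt d) → ℝ} {p : ℝ}

omit [IsProbabilityMeasure μ] in
lemma measurable_addOneCost_inCube (hH : Measurable H) (hP : IsHomogeneousPoisson lam P μ)
    (y : Pt d) (a : ℝ) : Measurable (fun ω => addOneCost H 0 ((P ω).inCube y a)) :=
  (measurable_addOneCost hH 0).comp (measurable_inCube_comp hP y a)

/-- The second moments of the add-one cost are uniformly bounded. -/
lemma exists_second_moment_bound (hp : 2 < p) (hm : UniformMomentBound H P μ p) :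
    ∃ C : ℝ≥0, ∀ (y : Pt d) (a : ℝ), 0 ∈ cube y a →
      ∫⁻ ω, ‖addOneCost H 0 ((P ω).inCube y a)‖ₑ ^ 2 ∂μ ≤ C := by
  set C := ⨆ (y : Pt d) (a : ℝ) (_ : 0 ∈ cube y a),
    ∫⁻ ω, ‖addOneCost H 0 ((P ω).inCube y a)‖ₑ ^ p ∂μ with hC
  have hCtop : C < ∞ := hm
  refine ⟨1 + C.toNNReal, fun y a h0 => ?_⟩
  have h1 : ∫⁻ ω, ‖addOneCost H 0 ((P ω).inCube y a)‖ₑ ^ p ∂μ ≤ C :=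
    le_iSup_of_le y (le_iSup_of_le a (le_iSup_of_le h0 le_rfl))
  have hpt (z : ℝ≥0∞) : z ^ 2 ≤ 1 + z ^ p := by
    rcases le_total z 1 with hz | hz
    · exact (pow_le_one₀ bot_le hz).trans le_self_add
    · refine le_trans ?_ le_add_self
      rw [← ENNReal.rpow_natCast]
      exact ENNReal.rpow_le_rpow_of_exponent_le hz (by norm_num; linarith)
  calc ∫⁻ ω, ‖addOneCost H 0 ((P ω).inCube y a)‖ₑ ^ 2 ∂μ
      ≤ ∫⁻ ω, (1 + ‖addOneCost H 0 ((P ω).inCube y a)‖ₑ ^ p) ∂μ := lintegral_mono fun ω => hpt _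
    _ = 1 + ∫⁻ ω, ‖addOneCost H 0 ((P ω).inCube y a)‖ₑ ^ p ∂μ := by
        rw [lintegral_add_left measurable_const]; simp
    _ ≤ 1 + C := by gcongr
    _ = ((1 + C.toNNReal : ℝ≥0) : ℝ≥0∞) := by
        rw [ENNReal.coe_add, ENNReal.coe_toNNReal hCtop.ne, ENNReal.coe_one]

/-- Weak stabilization in `L²`, uniformly: the add-one costs in any two cubes that contain a large
neighbourhood of the origin are close. Otherwise there would be two sequences of cubes growing to
the whole space along which the add-one costs stay apart. -/
lemma exists_radius (hH : Measurable H) (hP : IsHomogeneousPoisson lam P μ)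
    (hs : WeaklyStabilizing H P μ) (hp : 2 < p) (hm : UniformMomentBound H P μ p)
    {ε : ℝ≥0∞} (hε : 0 < ε) :
    ∃ r : ℝ, 0 < r ∧ ∀ (y y' : Pt d) (a a' : ℝ),
      (∀ x : Pt d, (∀ i, |x i| < r) → x ∈ cube y a) →
      (∀ x : Pt d, (∀ i, |x i| < r) → x ∈ cube y' a') →
      ∫⁻ ω, ‖addOneCost H 0 ((P ω).inCube y a) - addOneCost H 0 ((P ω).inCube y' a')‖ₑ ^ 2 ∂μ
        ≤ ε := by
  by_contra! hcon
  have hcon' (k : ℕ) := hcon (k + 1) (by positivity)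
  choose y y' a a' hy hy' hgt using hcon'
  obtain ⟨Δ, -, hΔ⟩ := hs
  have h0 (k : ℕ) (x : Pt d) (hx : ‖x‖ ≤ k) : ∀ i, |x i| < (k : ℝ) + 1 := fun i =>
    ((PiLp.norm_apply_le x i).trans hx).trans_lt (by linarith)
  have hev (x : Pt d) : ∀ᶠ k : ℕ in atTop, ‖x‖ ≤ k :=
    tendsto_natCast_atTop_atTop.eventually_ge_atTop _
  have hz (k : ℕ) : 0 ∈ cube (y k) (a k) := hy k 0 (h0 k 0 (by simp))
  have hz' (k : ℕ) : 0 ∈ cube (y' k) (a' k) := hy' k 0 (h0 k 0 (by simp))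
  have hlim := hΔ y a hz (fun x => (hev x).mono fun k hk => hy k x (h0 k x hk))
  have hlim' := hΔ y' a' hz' (fun x => (hev x).mono fun k hk => hy' k x (h0 k x hk))
  set C := ⨆ (y : Pt d) (a : ℝ) (_ : 0 ∈ cube y a),
    ∫⁻ ω, ‖addOneCost H 0 ((P ω).inCube y a)‖ₑ ^ p ∂μ with hC
  have hCtop : C < ∞ := hm
  have hle (y : Pt d) (a : ℝ) (h0 : 0 ∈ cube y a) :
      ∫⁻ ω, ‖addOneCost H 0 ((P ω).inCube y a)‖ₑ ^ p ∂μ ≤ C :=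
    le_iSup_of_le y (le_iSup_of_le a (le_iSup_of_le h0 le_rfl))
  have hmeas (k : ℕ) := measurable_addOneCost_inCube hH hP (y k) (a k)
  have hmeas' (k : ℕ) := measurable_addOneCost_inCube hH hP (y' k) (a' k)
  have key := tendsto_lintegral_sq_of_ae (μ := μ)
    (Z := fun k ω => addOneCost H 0 ((P ω).inCube (y k) (a k)) -
      addOneCost H 0 ((P ω).inCube (y' k) (a' k)))
    (fun k => (hmeas k).sub (hmeas' k)) hp (C := 2 ^ (p - 1) * (C + C))
    (ENNReal.mul_lt_top (ENNReal.rpow_lt_top_of_nonneg (by linarith) (by simp))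
      (ENNReal.add_lt_top.2 ⟨hCtop, hCtop⟩)) (fun k => ?_) ?_
  · rw [ENNReal.tendsto_nhds_zero] at key
    obtain ⟨k, hk⟩ := (key ε hε).exists
    exact absurd hk (not_le.2 (hgt k))
  · calc _ ≤ ∫⁻ ω, 2 ^ (p - 1) * (‖addOneCost H 0 ((P ω).inCube (y k) (a k))‖ₑ ^ p +
          ‖addOneCost H 0 ((P ω).inCube (y' k) (a' k))‖ₑ ^ p) ∂μ := by
          refine lintegral_mono fun ω => ?_
          refine (ENNReal.rpow_le_rpow enorm_sub_le (by linarith)).trans ?_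
          exact ENNReal.rpow_add_le_mul_rpow_add_rpow _ _ (by linarith)
      _ ≤ _ := by
          rw [lintegral_const_mul, lintegral_add_left ((hmeas k).enorm.pow_const p)]
          swap
          · exact ((hmeas k).enorm.pow_const p).add ((hmeas' k).enorm.pow_const p)
          gcongr
          exacts [hle _ _ (hz k), hle _ _ (hz' k)]
  · filter_upwards [hlim, hlim'] with ω h1 h2
    simpa using h1.sub h2

lemma zero_mem_cube_sub {x y : Pt d} {a : ℝ} (hx : x ∈ cube y a) : 0 ∈ cube (y - x) a := by
  rw [mem_cube_sub, zero_add]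
  exact hx

lemma lintegral_poissonLaw [NeZero d] (hP : IsHomogeneousPoisson lam P μ) (y : Pt d) (a : ℝ)
    {Φ : Finset (Pt d) → ℝ≥0∞} (hΦ : Measurable Φ) :
    ∫⁻ s, Φ s ∂(poissonLaw (cubeIntensity lam y a)) = ∫⁻ ω, Φ ((P ω).inCube y a) ∂μ := by
  rw [← map_inCube hP, lintegral_map hΦ (measurable_inCube_comp hP y a)]

/-- By stationarity, the add-one cost at `x` is in law the one at the origin, in the
shifted cube. -/
lemma lintegral_addOneCost_sq [NeZero d] (hH : Measurable H) (hinv : TranslationInvariant H)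
    (hP : IsHomogeneousPoisson lam P μ) (x y : Pt d) (a : ℝ) :
    ∫⁻ s, ‖addOneCost H x s‖ₑ ^ 2 ∂(poissonLaw (cubeIntensity lam y a)) =
      ∫⁻ ω, ‖addOneCost H 0 ((P ω).inCube (y - x) a)‖ₑ ^ 2 ∂μ := by
  rw [lintegral_poissonLaw hP y a ((measurable_addOneCost hH x).enorm.pow_const 2)]
  simp only [addOneCost_eq_map hinv x]
  exact lintegral_inCube_sub hP ((measurable_addOneCost hH 0).enorm.pow_const 2) x y a

open Classical in
/-- By stationarity, add-one costs at `x` in two nested cubes are jointly in law those at the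
origin, in the shifted cubes. -/
lemma lintegral_addOneCost_sub_sq [NeZero d] (hH : Measurable H) (hinv : TranslationInvariant H)
    (hP : IsHomogeneousPoisson lam P μ) (x : Pt d) {y y' : Pt d} {a a' : ℝ}
    (hsub : cube y' a' ⊆ cube y a) :
    ∫⁻ s, ‖addOneCost H x s - addOneCost H x (s.filter (· ∈ cube y' a'))‖ₑ ^ 2
        ∂(poissonLaw (cubeIntensity lam y a)) =
      ∫⁻ ω, ‖addOneCost H 0 ((P ω).inCube (y - x) a) -
        addOneCost H 0 ((P ω).inCube (y' - x) a')‖ₑ ^ 2 ∂μ := by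
  have hm (x : Pt d) (y' : Pt d) : Measurable (fun s : Finset (Pt d) =>
      ‖addOneCost H x s - addOneCost H x (s.filter (· ∈ cube y' a'))‖ₑ ^ 2) :=
    ((measurable_addOneCost hH x).sub ((measurable_addOneCost hH x).comp
      (measurable_filter (measurableSet_cube y' a')))).enorm.pow_const 2
  rw [lintegral_poissonLaw hP y a (hm x y')]
  have e (s : Finset (Pt d)) : (s.filter (· ∈ cube y' a')).map (addLeftEmbedding (-x)) =
      (s.map (addLeftEmbedding (-x))).filter (· ∈ cube (y' - x) a') := by
    ext z
    simp only [Finset.mem_map, Finset.mem_filter, mem_cube_sub]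
    constructor
    · rintro ⟨w, ⟨hw, hwc⟩, rfl⟩
      exact ⟨⟨w, hw, rfl⟩, by simpa using hwc⟩
    · rintro ⟨⟨w, hw, rfl⟩, hwc⟩
      exact ⟨w, ⟨hw, by simpa using hwc⟩, rfl⟩
  simp only [addOneCost_eq_map hinv x, e]
  rw [lintegral_inCube_sub hP (hm 0 (y' - x)) x y a]
  have hsub' : cube (y' - x) a' ⊆ cube (y - x) a := fun z hz => by
    rw [mem_cube_sub] at hz ⊢
    exact hsub hz
  simp only [inCube_filter _ hsub']

end Stabilization

/-! ### Cells and the variance of the approximation error -/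

section Cells

variable {d : ℕ}

lemma volume_cube (y : Pt d) (a : ℝ) : volume (cube y a) = ENNReal.ofReal a ^ d := by
  have h : cube y a = (MeasurableEquiv.toLp 2 (Fin d → ℝ)).symm ⁻¹'
      (Set.univ.pi fun i => Set.Ico (y i) (y i + a)) := by
    ext x
    simp [cube, Set.mem_pi]
  rw [h, (EuclideanSpace.volume_preserving_symm_measurableEquiv_toLp
    (Fin d)).measure_preimage_equiv, Real.volume_pi_Ico]
  simp

/-- The lower corner of the cell with index `j` in the partition of the orthant into cubes of
side length `a`. -/
noncomputable def corner (a : ℝ) {k : ℕ} (j : Fin d → Fin k) : Pt d :=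
  WithLp.toLp 2 fun i => a * (j i : ℕ)

/-- The middle part of the cell with index `j`: the cell shrunk by `r` on each side. -/
def core (a r : ℝ) {k : ℕ} (j : Fin d → Fin k) : Set (Pt d) :=
  cube (corner a j + WithLp.toLp 2 fun _ => r) (a - 2 * r)

section Cells

variable {a r : ℝ} {k : ℕ}

lemma disjoint_cell (ha : 0 < a) :
    Pairwise fun i j : Fin d → Fin k => Disjoint (cube (corner a i) a) (cube (corner a j) a) := by
  intro i j hij
  refine Set.disjoint_left.2 fun x hx hx' => hij ?_
  funext l
  obtain ⟨h1, h2⟩ := hx l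
  obtain ⟨h3, h4⟩ := hx' l
  simp only [corner] at h1 h2 h3 h4
  have h5 : ((i l : ℕ) : ℝ) < (j l : ℕ) + 1 := by nlinarith
  have h6 : ((j l : ℕ) : ℝ) < (i l : ℕ) + 1 := by nlinarith
  norm_cast at h5 h6
  omega

lemma cell_subset {L : ℝ} (ha : 0 < a) (hk : k * a ≤ L) (j : Fin d → Fin k) :
    cube (corner a j) a ⊆ cube 0 L := by
  intro x hx i
  obtain ⟨h1, h2⟩ := hx i
  simp only [corner, PiLp.zero_apply] at h1 h2 ⊢
  have h3 : ((j i : ℕ) : ℝ) + 1 ≤ k := by exact_mod_cast (j i).2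
  constructor
  · exact le_trans (by positivity) h1
  · nlinarith

lemma core_subset (hr : 0 < r) (j : Fin d → Fin k) : core a r j ⊆ cube (corner a j) a := by
  intro x hx i
  obtain ⟨h1, h2⟩ := hx i
  simp only [PiLp.add_apply] at h1 h2
  constructor <;> linarith

lemma mem_cell_sub_of_mem_core {j : Fin d → Fin k} {x z : Pt d} (hx : x ∈ core a r j)
    (hz : ∀ i, |z i| < r) : z ∈ cube (corner a j - x) a := by
  rw [mem_cube_sub]
  intro i
  obtain ⟨h1, h2⟩ := hx i
  obtain ⟨h3, h4⟩ := abs_lt.1 (hz i)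
  simp only [PiLp.add_apply] at h1 h2 ⊢
  constructor <;> linarith

/-- The cores fill the window up to a boundary layer around each cell. -/
lemma volume_diff_cores {L : ℝ} (ha : 0 < a) (hr : 0 < r) (har : 2 * r < a) (hL : 0 ≤ L)
    (hk : k * a ≤ L) :
    volume (cube (0 : Pt d) L \ ⋃ j : Fin d → Fin k, core a r j) =
      ENNReal.ofReal (L ^ d - k ^ d * (a - 2 * r) ^ d) := by
  have h0 : 0 ≤ a - 2 * r := by linarith
  have hU : volume (⋃ j : Fin d → Fin k, core (d := d) a r j) =
      ENNReal.ofReal (k ^ d * (a - 2 * r) ^ d) := by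
    rw [measure_iUnion (fun i j hij => (disjoint_cell ha hij).mono (core_subset hr i)
      (core_subset hr j)) (fun j => measurableSet_cube _ _)]
    simp only [core, volume_cube, tsum_fintype, Finset.sum_const, Finset.card_univ,
      Fintype.card_fun, Fintype.card_fin, nsmul_eq_mul]
    rw [ENNReal.ofReal_mul (by positivity), ENNReal.ofReal_pow h0,
      ENNReal.ofReal_pow (by positivity)]
    simp
  rw [measure_sdiff (Set.iUnion_subset fun j => (core_subset hr j).trans (cell_subset ha hk j))
    (MeasurableSet.iUnion fun j => measurableSet_cube _ _).nullMeasurableSet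
    (hU ▸ ENNReal.ofReal_ne_top),
    hU, volume_cube, ENNReal.ofReal_sub _ (by positivity), ENNReal.ofReal_pow hL]

end Cells

open Classical in
/-- The difference between the functional and the sum of its values on the cells. -/
noncomputable def cellError (H : Finset (Pt d) → ℝ) (a : ℝ) (k : ℕ) (s : Finset (Pt d)) : ℝ :=
  H s - ∑ j : Fin d → Fin k, H (s.filter (· ∈ cube (corner a j) a))

section CellError

variable {H : Finset (Pt d) → ℝ} {a : ℝ} {k : ℕ}

lemma measurable_cellError (hH : Measurable H) : Measurable (cellError H a k) :=
  hH.sub (Finset.measurable_fun_sum _ fun _ _ =>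
    hH.comp (measurable_filter (measurableSet_cube _ _)))

open Classical in
/-- Only the cell that contains `x` is affected by adding `x`. -/
lemma addOneCost_cellError_of_mem (ha : 0 < a) {j : Fin d → Fin k} {x : Pt d}
    (hx : x ∈ cube (corner a j) a) (s : Finset (Pt d)) :
    addOneCost (cellError H a k) x s =
      addOneCost H x s - addOneCost H x (s.filter (· ∈ cube (corner a j) a)) := by
  have h : ∑ i : Fin d → Fin k, (H ((insert x s).filter (· ∈ cube (corner a i) a)) -
      H (s.filter (· ∈ cube (corner a i) a))) =
      H (insert x (s.filter (· ∈ cube (corner a j) a))) -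
        H (s.filter (· ∈ cube (corner a j) a)) := by
    rw [Finset.sum_eq_single j]
    · rw [Finset.filter_insert, if_pos hx]
    · intro i _ hij
      rw [Finset.filter_insert, if_neg, sub_self]
      exact fun hxi => Set.disjoint_left.1 (disjoint_cell ha hij) hxi hx
    · simp
  rw [Finset.sum_sub_distrib] at h
  unfold addOneCost cellError
  linarith

open Classical in
lemma addOneCost_cellError_of_notMem {x : Pt d}
    (hx : ∀ j : Fin d → Fin k, x ∉ cube (corner a j) a) (s : Finset (Pt d)) :
    addOneCost (cellError H a k) x s = addOneCost H x s := by
  unfold addOneCost cellError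
  have h (j : Fin d → Fin k) : (insert x s).filter (· ∈ cube (corner a j) a) =
      s.filter (· ∈ cube (corner a j) a) := by
    rw [Finset.filter_insert, if_neg (hx j)]
  simp only [h]
  ring

end CellError

variable {Ω : Type*} [MeasurableSpace Ω] {μ : Measure Ω} [IsProbabilityMeasure μ]
  {lam : ℝ≥0} {P : Ω → Configuration d} {H : Finset (Pt d) → ℝ}

section SecondMoments

variable [NeZero d] (hH : Measurable H) (hinv : TranslationInvariant H)
  (hP : IsHomogeneousPoisson lam P μ) {C : ℝ≥0}
  (hC : ∀ (y : Pt d) (a : ℝ), 0 ∈ cube y a →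
    ∫⁻ ω, ‖addOneCost H 0 ((P ω).inCube y a)‖ₑ ^ 2 ∂μ ≤ C)

include hH hinv hP hC

lemma lintegral_addOneCost_sq_le {x y : Pt d} {a : ℝ} (hx : x ∈ cube y a) :
    ∫⁻ s, ‖addOneCost H x s‖ₑ ^ 2 ∂(poissonLaw (cubeIntensity lam y a)) ≤ C := by
  rw [lintegral_addOneCost_sq hH hinv hP]
  exact hC _ _ (zero_mem_cube_sub hx)

lemma memLp_functional (y : Pt d) (a : ℝ) : MemLp (fun ω => H ((P ω).inCube y a)) 2 μ := by
  have h : MemLp H 2 (poissonLaw (cubeIntensity lam y a)) := by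
    refine (poincare_poissonLaw hH ?_).1
    calc _ ≤ ∫⁻ _, (C : ℝ≥0∞) ∂(cubeIntensity lam y a) := by
          refine lintegral_mono_ae ?_
          have : ∀ᵐ x ∂(cubeIntensity lam y a), x ∈ cube y a :=
            Measure.ae_smul_measure (ae_restrict_mem (measurableSet_cube y a)) lam
          filter_upwards [this] with x hx
          exact lintegral_addOneCost_sq_le hH hinv hP hC hx
      _ < ∞ := by
          rw [lintegral_const]
          exact ENNReal.mul_lt_top ENNReal.coe_lt_top (measure_lt_top _ _)
  rw [← map_inCube hP] at h
  exact h.comp_of_map (measurable_inCube_comp hP y a).aemeasurable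

omit hC in
/-- The second moment of the add-one cost of the cell error is small in the cores of the cells. -/
lemma lintegral_addOneCost_cellError_le_of_core {ε : ℝ≥0∞} {r a L : ℝ} {k : ℕ}
    (hε : ∀ (y y' : Pt d) (a a' : ℝ),
      (∀ x : Pt d, (∀ i, |x i| < r) → x ∈ cube y a) →
      (∀ x : Pt d, (∀ i, |x i| < r) → x ∈ cube y' a') →
      ∫⁻ ω, ‖addOneCost H 0 ((P ω).inCube y a) - addOneCost H 0 ((P ω).inCube y' a')‖ₑ ^ 2 ∂μ
        ≤ ε) (ha : 0 < a) (hr : 0 < r) (hk : k * a ≤ L) {j : Fin d → Fin k} {x : Pt d}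
    (hx : x ∈ core a r j) :
    ∫⁻ s, ‖addOneCost (cellError H a k) x s‖ₑ ^ 2 ∂(poissonLaw (cubeIntensity lam 0 L)) ≤ ε := by
  simp only [addOneCost_cellError_of_mem ha (core_subset hr j hx)]
  rw [lintegral_addOneCost_sub_sq hH hinv hP x (cell_subset ha hk j)]
  refine hε _ _ _ _ (fun z hz => ?_) (fun z hz => mem_cell_sub_of_mem_core hx hz)
  have h := mem_cell_sub_of_mem_core hx hz
  rw [mem_cube_sub] at h ⊢
  exact cell_subset ha hk j h

/-- The second moment of the add-one cost of the cell error is bounded everywhere. -/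
lemma lintegral_addOneCost_cellError_le {a L : ℝ} {k : ℕ} (ha : 0 < a) (hk : k * a ≤ L) {x : Pt d}
    (hx : x ∈ cube 0 L) :
    ∫⁻ s, ‖addOneCost (cellError H a k) x s‖ₑ ^ 2 ∂(poissonLaw (cubeIntensity lam 0 L)) ≤
      4 * C := by
  by_cases hcell : ∃ j : Fin d → Fin k, x ∈ cube (corner a j) a
  · obtain ⟨j, hj⟩ := hcell
    simp only [addOneCost_cellError_of_mem ha hj]
    rw [lintegral_addOneCost_sub_sq hH hinv hP x (cell_subset ha hk j)]
    calc _ ≤ ∫⁻ ω, (2 * ‖addOneCost H 0 ((P ω).inCube (0 - x) L)‖ₑ ^ 2 +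
          2 * ‖addOneCost H 0 ((P ω).inCube (corner a j - x) a)‖ₑ ^ 2) ∂μ :=
          lintegral_mono fun ω => enorm_sub_sq_le _ _
      _ = 2 * ∫⁻ ω, ‖addOneCost H 0 ((P ω).inCube (0 - x) L)‖ₑ ^ 2 ∂μ +
          2 * ∫⁻ ω, ‖addOneCost H 0 ((P ω).inCube (corner a j - x) a)‖ₑ ^ 2 ∂μ := by
          have hm (y : Pt d) (b : ℝ) := (measurable_addOneCost_inCube hH hP y b).enorm.pow_const 2
          rw [lintegral_add_left ((hm _ _).const_mul 2), lintegral_const_mul _ (hm _ _),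
            lintegral_const_mul _ (hm _ _)]
      _ ≤ 2 * C + 2 * C := by
          gcongr
          exacts [hC _ _ (zero_mem_cube_sub hx), hC _ _ (zero_mem_cube_sub hj)]
      _ = 4 * C := by ring
  · simp only [not_exists] at hcell
    simp only [addOneCost_cellError_of_notMem hcell]
    calc _ ≤ (C : ℝ≥0∞) := lintegral_addOneCost_sq_le hH hinv hP hC hx
      _ = 1 * C := (one_mul _).symm
      _ ≤ 4 * C := by gcongr; norm_num

/-- The sum over the cells approximates the functional: by the Poincaré inequality, only the points
outside the cores contribute to the variance of the difference in a significant way. -/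
theorem variance_sub_sum_cells_le {ε r a L : ℝ} {k : ℕ} (hε0 : 0 ≤ ε)
    (hε : ∀ (y y' : Pt d) (a a' : ℝ),
      (∀ x : Pt d, (∀ i, |x i| < r) → x ∈ cube y a) →
      (∀ x : Pt d, (∀ i, |x i| < r) → x ∈ cube y' a') →
      ∫⁻ ω, ‖addOneCost H 0 ((P ω).inCube y a) - addOneCost H 0 ((P ω).inCube y' a')‖ₑ ^ 2 ∂μ
        ≤ ENNReal.ofReal ε) (hr : 0 < r) (har : 2 * r < a) (hL : 0 ≤ L) (hk : k * a ≤ L) :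
    Var[(fun ω => H ((P ω).inCube 0 L)) -
        fun ω => ∑ j : Fin d → Fin k, H ((P ω).inCube (corner a j) a); μ] ≤
      lam * (ε * L ^ d + 4 * C * (L ^ d - k ^ d * (a - 2 * r) ^ d)) := by
  have ha : 0 < a := by linarith
  have hnn : 0 ≤ L ^ d - k ^ d * (a - 2 * r) ^ d := by
    rw [← mul_pow, sub_nonneg]
    refine pow_le_pow_left₀ (mul_nonneg (by positivity) (by linarith)) (hk.trans' ?_) d
    gcongr
    linarith
  have hUm : MeasurableSet (⋃ j : Fin d → Fin k, core (d := d) a r j) :=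
    MeasurableSet.iUnion fun j => measurableSet_cube _ _
  have hUsub : (⋃ j : Fin d → Fin k, core (d := d) a r j) ⊆ cube 0 L :=
    Set.iUnion_subset fun j => (core_subset hr j).trans (cell_subset ha hk j)
  set f : Pt d → ℝ≥0∞ := fun x =>
    ∫⁻ s, ‖addOneCost (cellError H a k) x s‖ₑ ^ 2 ∂(poissonLaw (cubeIntensity lam 0 L)) with hf
  have hbound : ∫⁻ x, f x ∂(cubeIntensity lam 0 L) ≤
      ENNReal.ofReal (lam * (ε * L ^ d + 4 * C * (L ^ d - k ^ d * (a - 2 * r) ^ d))) := by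
    rw [cubeIntensity, lintegral_smul_measure, ENNReal.smul_def, smul_eq_mul,
      ENNReal.ofReal_mul lam.coe_nonneg, ENNReal.ofReal_coe_nnreal]
    gcongr
    have hsplit := Set.union_sdiff_cancel hUsub
    calc ∫⁻ x in cube 0 L, f x
        ≤ (∫⁻ x in ⋃ j : Fin d → Fin k, core (d := d) a r j, f x) +
          ∫⁻ x in cube 0 L \ ⋃ j : Fin d → Fin k, core (d := d) a r j, f x := by
          conv_lhs => rw [← hsplit]
          exact lintegral_union_le _ _ _
      _ ≤ (∫⁻ _ in ⋃ j : Fin d → Fin k, core (d := d) a r j, ENNReal.ofReal ε) +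
          ∫⁻ _ in cube (0 : Pt d) L \ ⋃ j : Fin d → Fin k, core (d := d) a r j, 4 * C := by
          refine add_le_add (setLIntegral_mono measurable_const fun x hx => ?_)
            (setLIntegral_mono measurable_const fun x hx =>
              lintegral_addOneCost_cellError_le hH hinv hP hC ha hk hx.1)
          obtain ⟨j, hj⟩ := Set.mem_iUnion.1 hx
          exact lintegral_addOneCost_cellError_le_of_core hH hinv hP hε ha hr hk hj
      _ ≤ ENNReal.ofReal ε * ENNReal.ofReal L ^ d +
          4 * C * ENNReal.ofReal (L ^ d - k ^ d * (a - 2 * r) ^ d) := by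
          rw [setLIntegral_const, setLIntegral_const, volume_diff_cores ha hr har hL hk,
            ← volume_cube (0 : Pt d) L]
          gcongr
      _ = _ := by
          rw [ENNReal.ofReal_add (by positivity) (by positivity), ENNReal.ofReal_mul hε0,
            ENNReal.ofReal_pow hL, ENNReal.ofReal_mul (by positivity),
            ENNReal.ofReal_mul (by positivity), ENNReal.ofReal_coe_nnreal]
          simp
  have hG := measurable_cellError (a := a) (k := k) hH
  have hvar := (poincare_poissonLaw hG (hbound.trans_lt ENNReal.ofReal_lt_top)).2
  have hcomp : (fun ω => H ((P ω).inCube 0 L)) -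
      (fun ω => ∑ j : Fin d → Fin k, H ((P ω).inCube (corner a j) a)) =
      cellError H a k ∘ fun ω => (P ω).inCube 0 L := by
    classical
    funext ω
    simp only [Pi.sub_apply, Function.comp, cellError]
    congr 1
    refine Finset.sum_congr rfl fun j _ => ?_
    rw [← inCube_filter _ (cell_subset ha hk j)]
  rw [hcomp, ← variance_map hG.aemeasurable (measurable_inCube_comp hP _ _).aemeasurable,
    map_inCube hP]
  refine hvar.trans (ENNReal.toReal_le_of_le_ofReal ?_ hbound)
  positivity

end SecondMoments

end Cells

/-! ### Sums over cells -/

section CellSums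

variable {d : ℕ} {Ω : Type*} [MeasurableSpace Ω] {μ : Measure Ω} [IsProbabilityMeasure μ]
  {lam : ℝ≥0} {P : Ω → Configuration d} {H : Finset (Pt d) → ℝ}

/-- By stationarity, the value of the functional on a cube depends in law only on the size of the
cube. -/
lemma identDistrib_functional [NeZero d] (hH : Measurable H) (hinv : TranslationInvariant H)
    (hP : IsHomogeneousPoisson lam P μ) (y : Pt d) (a : ℝ) :
    IdentDistrib (fun ω => H ((P ω).inCube y a)) (fun ω => H ((P ω).inCube 0 a)) μ μ where
  aemeasurable_fst := (hH.comp (measurable_inCube_comp hP y a)).aemeasurable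
  aemeasurable_snd := (hH.comp (measurable_inCube_comp hP 0 a)).aemeasurable
  map_eq := by
    have hP' := isHomogeneousPoisson_translate hP y
    have e : (fun ω => H ((P ω).inCube y a)) = H ∘ fun ω => (translate (P ω) y).inCube 0 a := by
      funext ω
      rw [Function.comp, ← sub_self y, inCube_translate, hinv]
    change μ.map _ = μ.map (H ∘ fun ω => (P ω).inCube 0 a)
    rw [e, ← Measure.map_map hH (measurable_inCube_comp hP' 0 a),
      ← Measure.map_map hH (measurable_inCube_comp hP 0 a), map_inCube hP', map_inCube hP]

/-- Variance and characteristic function of the sum over the cells, whose summands are independent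
and identically distributed. -/
lemma variance_charFun_sum_cells [NeZero d] (hH : Measurable H) (hinv : TranslationInvariant H)
    (hP : IsHomogeneousPoisson lam P μ) {a : ℝ} (ha : 0 < a)
    (hL : ∀ y : Pt d, MemLp (fun ω => H ((P ω).inCube y a)) 2 μ) (k : ℕ) :
    Var[fun ω => ∑ j : Fin d → Fin k, H ((P ω).inCube (corner a j) a); μ] =
      ((k ^ d : ℕ) : ℝ) * Var[fun ω => H ((P ω).inCube 0 a); μ] ∧
    ∀ t, charFun (μ.map (centre μ fun ω =>
        ∑ j : Fin d → Fin k, H ((P ω).inCube (corner a j) a))) t =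
      charFun (μ.map (centre μ fun ω => H ((P ω).inCube 0 a))) t ^ (k ^ d) := by
  set X : (Fin d → Fin k) → Ω → ℝ := fun j ω => H ((P ω).inCube (corner a j) a) with hX
  have hind : iIndepFun X μ := (iIndepFun_inCube hP (disjoint_cell ha)).comp (fun _ => H)
    fun _ => hH
  have hid (j : Fin d → Fin k) := identDistrib_functional hH hinv hP (corner a j) a
  have hcard : Fintype.card (Fin d → Fin k) = k ^ d := by simp
  constructor
  · have h := IndepFun.variance_sum (s := Finset.univ) (X := X) (fun j _ => hL _)
      (fun i _ j _ hij => hind.indepFun hij)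
    have e : (fun ω => ∑ j, X j ω) = ∑ j, X j := by
      funext ω
      simp
    rw [e, h, Finset.sum_congr rfl fun j _ => (hid j).variance_eq, Finset.sum_const,
      Finset.card_univ, hcard, nsmul_eq_mul]
  · intro t
    have e : (centre μ fun ω => ∑ j, X j ω) = fun ω => ∑ j, centre μ (X j) ω := by
      funext ω
      simp only [centre]
      rw [integral_finsetSum _ fun j _ => (hL _).integrable one_le_two, Finset.sum_sub_distrib]
    have hc (j : Fin d → Fin k) : centre μ (X j) = (fun x => x - ∫ ω, X j ω ∂μ) ∘ X j := rfl
    have hind' : iIndepFun (fun j => centre μ (X j)) μ := by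
      exact hind.comp (fun j x => x - ∫ ω, X j ω ∂μ) fun j => measurable_sub_const _
    rw [e, hind'.charFun_map_fun_sum_eq_prod fun j =>
      (memLp_centre (hL _)).aestronglyMeasurable.aemeasurable, Finset.prod_apply]
    have hlaw (j : Fin d → Fin k) :
        μ.map (centre μ (X j)) = μ.map (centre μ fun ω => H ((P ω).inCube 0 a)) := by
      have h := ((hid j).comp (measurable_sub_const (∫ ω, X j ω ∂μ))).map_eq
      have hint : ∫ ω, X j ω ∂μ = ∫ ω, H ((P ω).inCube 0 a) ∂μ := (hid j).integral_eq
      rw [hc, h, hint]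
      rfl
    change ∏ j, charFun (μ.map (centre μ (X j))) t = _
    simp only [hlaw, Finset.prod_const, Finset.card_univ, hcard]

/-- The number of cells per unit of volume. -/
lemma tendsto_card_cells_div [NeZero d] {a : ℝ} (ha : 0 < a) :
    Tendsto (fun n : ℝ => ((⌊n ^ (1 / (d : ℝ)) / a⌋₊ ^ d : ℕ) : ℝ) / n) atTop (𝓝 (1 / a ^ d)) := by
  have hd : (0 : ℝ) < d := by exact_mod_cast NeZero.pos d
  have h1 : Tendsto (fun n : ℝ => n ^ (1 / (d : ℝ))) atTop atTop :=
    tendsto_rpow_atTop (by positivity)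
  have h2 := ((tendsto_nat_floor_mul_div_atTop (R := ℝ) (a := 1 / a) (by positivity)).comp h1).pow d
  rw [one_div_pow] at h2
  refine h2.congr' ?_
  filter_upwards [eventually_ge_atTop 0] with n hn
  have h3 : (n ^ (1 / (d : ℝ))) ^ d = n := by
    rw [one_div, Real.rpow_inv_natCast_pow hn (NeZero.ne d)]
  simp only [Function.comp]
  rw [div_pow, h3, one_div_mul_eq_div]
  push_cast
  rfl

/-- A variance limit and the characteristic function form of the central limit theorem. -/
theorem exists_tendsto_functionalOnCube [NeZero d] (hH : Measurable H)
    (hinv : TranslationInvariant H) (hP : IsHomogeneousPoisson lam P μ)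
    (hs : WeaklyStabilizing H P μ) {p : ℝ} (hp : 2 < p) (hm : UniformMomentBound H P μ p) :
    (∀ n, MemLp (functionalOnCube H P n) 2 μ) ∧
    ∃ v : ℝ≥0, Tendsto (fun n : ℝ => Var[functionalOnCube H P n; μ] / n) atTop (𝓝 (v : ℝ)) ∧
      ∀ t : ℝ, Tendsto
        (fun n : ℝ => charFun (μ.map (centre μ (functionalOnCube H P n))) ((√n)⁻¹ * t)) atTop
        (𝓝 (Complex.exp (-(v * t ^ 2 / 2 : ℝ)))) := by
  obtain ⟨C, hC⟩ := exists_second_moment_bound hp hm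
  have hL (y : Pt d) (a : ℝ) : MemLp (fun ω => H ((P ω).inCube y a)) 2 μ :=
    memLp_functional hH hinv hP hC y a
  refine ⟨fun n => hL _ _, exists_tendsto_of_approx (fun n _ => hL _ _) fun ε hε => ?_⟩
  set ε₁ : ℝ := ε / (2 * (lam + 1)) with hε₁
  have hε₁0 : 0 < ε₁ := by positivity
  obtain ⟨r, hr, hrad⟩ := exists_radius hH hP hs hp hm (ENNReal.ofReal_pos.2 hε₁0)
  -- the proportion of the volume outside the cores vanishes for large cells
  obtain ⟨a, har, ha4⟩ : ∃ a : ℝ, 2 * r < a ∧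
      lam * (4 * C * (1 - 1 / a ^ d * (a - 2 * r) ^ d)) < ε / 2 := by
    have h1 : Tendsto (fun a : ℝ => lam * (4 * C * (1 - (1 - 2 * r / a) ^ d))) atTop
        (𝓝 (lam * (4 * C * (1 - (1 - 0) ^ d)))) :=
      ((tendsto_const_nhds.sub ((tendsto_const_nhds.sub
        (tendsto_const_nhds.div_atTop tendsto_id)).pow d)).const_mul _).const_mul _
    simp only [sub_zero, one_pow, sub_self, mul_zero] at h1
    obtain ⟨a, h2, h3⟩ := ((h1.eventually_lt_const (half_pos hε)).and
      (eventually_gt_atTop (2 * r))).exists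
    have ha : a ≠ 0 := by linarith
    refine ⟨a, h3, ?_⟩
    have e : 1 / a ^ d * (a - 2 * r) ^ d = (1 - 2 * r / a) ^ d := by
      rw [← one_div_pow, ← mul_pow]
      congr 1
      field_simp
    rw [e]
    exact h2
  have ha : 0 < a := by linarith
  refine ⟨1 / a ^ d, fun ω => H ((P ω).inCube 0 a), fun n => ⌊n ^ (1 / (d : ℝ)) / a⌋₊ ^ d,
    fun n ω => ∑ j : Fin d → Fin ⌊n ^ (1 / (d : ℝ)) / a⌋₊, H ((P ω).inCube (corner a j) a),
    by positivity, hL _ _, tendsto_card_cells_div ha, ?_⟩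
  have hlim : Tendsto (fun n : ℝ => lam * (ε₁ + 4 * C *
      (1 - ((⌊n ^ (1 / (d : ℝ)) / a⌋₊ ^ d : ℕ) : ℝ) / n * (a - 2 * r) ^ d))) atTop
      (𝓝 (lam * (ε₁ + 4 * C * (1 - 1 / a ^ d * (a - 2 * r) ^ d)))) :=
    (((((tendsto_card_cells_div ha).mul_const _).const_sub 1).const_mul _).const_add _).const_mul _
  have hlt : lam * (ε₁ + 4 * C * (1 - 1 / a ^ d * (a - 2 * r) ^ d)) < ε := by
    have h1 : lam * ε₁ ≤ ε / 2 := by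
      rw [hε₁, mul_div_assoc', div_le_div_iff₀ (by positivity) two_pos]
      nlinarith
    rw [mul_add]
    linarith
  filter_upwards [hlim.eventually_lt_const hlt, eventually_gt_atTop 0] with n hn hn0
  obtain ⟨hvar, hchar⟩ := variance_charFun_sum_cells hH hinv hP ha (fun y => hL y a)
    ⌊n ^ (1 / (d : ℝ)) / a⌋₊
  refine ⟨memLp_finsetSum _ fun j _ => hL _ _, hvar, hchar, ?_⟩
  have hL0 : 0 ≤ n ^ (1 / (d : ℝ)) := by positivity
  have hpow : (n ^ (1 / (d : ℝ))) ^ d = n := by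
    rw [one_div, Real.rpow_inv_natCast_pow hn0.le (NeZero.ne d)]
  have hk : (⌊n ^ (1 / (d : ℝ)) / a⌋₊ : ℝ) * a ≤ n ^ (1 / (d : ℝ)) := by
    rw [← le_div_iff₀ ha]
    exact Nat.floor_le (by positivity)
  refine (variance_sub_sum_cells_le hH hinv hP hC hε₁0.le hrad hr har hL0 hk).trans ?_
  rw [hpow]
  refine le_trans (le_of_eq ?_) (mul_le_mul_of_nonneg_right hn.le hn0.le)
  push_cast
  field_simp

end CellSums

end PoissonCLT


open PoissonCLT in
theorem theorem3p1 (d : ℕ) (hd : 1 ≤ d)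
    (H : Finset (EuclideanSpace ℝ (Fin d)) → ℝ)
    (hmeas : MeasurableFunctional H) (hinv : TranslationInvariant H) :
    ∃ σ2 : ℝ≥0 → ℝ≥0, ∀ (lam : ℝ≥0) (Ω : Type*) (_ : MeasurableSpace Ω) (μ : Measure Ω)
      (_ : IsProbabilityMeasure μ) (P : Ω → Configuration d),
      IsHomogeneousPoisson lam P μ →
      WeaklyStabilizing H P μ →
      (∃ p : ℝ, 2 < p ∧ UniformMomentBound H P μ p) →
      (∀ n : ℝ, 0 < n → MemLp (functionalOnCube H P n) 2 μ) ∧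
      Tendsto (fun n : ℝ => Var[functionalOnCube H P n; μ] / n) atTop (𝓝 (σ2 lam : ℝ)) ∧
      TendstoInDistribution
        (fun (n : ℝ) (ω : Ω) =>
          (functionalOnCube H P n ω - ∫ ω', functionalOnCube H P n ω' ∂μ) / √n)
        atTop id (fun _ => μ) (gaussianReal 0 (σ2 lam)) := by
  have : NeZero d := ⟨by omega⟩
  have hH : Measurable H := hmeas
  -- the limit is written in terms of the Poisson law alone, so that it does not depend on the
  -- probability space
  refine ⟨fun lam => (limUnder atTop fun n : ℝ =>
    Var[H; poissonLaw (cubeIntensity lam 0 (n ^ (1 / (d : ℝ))))] / n).toNNReal, ?_⟩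
  rintro lam Ω _ μ _ P hP hs ⟨p, hp, hm⟩
  obtain ⟨hL, v, hv, hchar⟩ := exists_tendsto_functionalOnCube hH hinv hP hs hp hm
  have hlaw (n : ℝ) : Var[H; poissonLaw (cubeIntensity lam 0 (n ^ (1 / (d : ℝ))))] =
      Var[functionalOnCube H P n; μ] := by
    rw [← map_inCube hP, variance_map hH.aemeasurable (measurable_inCube_comp hP _ _).aemeasurable]
    rfl
  obtain rfl : v = (limUnder atTop fun n : ℝ =>
      Var[H; poissonLaw (cubeIntensity lam 0 (n ^ (1 / (d : ℝ))))] / n).toNNReal := by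
    simp only [hlaw]
    rw [hv.limUnder_eq, Real.toNNReal_coe]
  refine ⟨fun n _ => hL n, hv, tendstoInDistribution_gaussian (fun n => ?_) fun t => ?_⟩
  · exact ((memLp_centre (hL n)).aestronglyMeasurable.aemeasurable).div_const _
  · refine (hchar t).congr fun n => ?_
    rw [← charFun_map_mul_comp (memLp_centre (hL n)).aestronglyMeasurable.aemeasurable]
    simp only [centre, div_eq_inv_mul]
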